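/- Let $\omega=\frac{1+\sqrt{-3}}{2}$. Call $(a,b)$ an Eisenstein pair if $a$ and $b$ are positive integers such that $a^2+ab+b^2$ is a perfect square. For $z\in\mathbb{C}$ with $|z|=1$, let $\ell(z)=\{tz : t\ge 0\}$ be the half-line which begins at $0$ and passes through $z$, let $\delta'(z,(a,b))$ be the Euclidean distance from $a+b\omega$ to $\ell(z)$, and let $$\delta(z)=\liminf_{(a,b)}\ \delta'(z,(a,b))\in[0,\infty],$$ where $(a,b)$ runs over the Eisenstein pairs, ordered by the absolute value $|a+b\omega|=\sqrt{a^2+ab+b^2}$. Then the greatest accumulation point in $\mathbb{R}$ of the set $$\{\delta(z) : z\in\mathbb{C},\ |z|=1,\ \delta(z)<\infty\}$$ is $\dfrac{\sqrt3}{4}$. -/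

import Mathlib

open Filter Topology

noncomputable section

/-- `ω = (1 + √-3) / 2`. -/
def eisensteinOmega : ℂ := (1 + (Real.sqrt 3 : ℂ) * Complex.I) / 2

/-- An Eisenstein pair: positive integers `a`, `b` such that `a² + ab + b²` is a perfect square. -/
def IsEisensteinPair (p : ℕ × ℕ) : Prop :=
  0 < p.1 ∧ 0 < p.2 ∧ IsSquare (p.1 ^ 2 + p.1 * p.2 + p.2 ^ 2)

/-- The point `a + bω` of the complex plane associated to the pair `(a, b)`. -/
def eisensteinPoint (p : ℕ × ℕ) : ℂ := (p.1 : ℂ) + (p.2 : ℂ) * eisensteinOmega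

/-- The half-line `ℓ(z)` which begins at `0` and passes through `z` (meant for `z ≠ 0`). -/
def halfLine (z : ℂ) : Set ℂ := {w | ∃ t : ℝ, 0 ≤ t ∧ w = (t : ℂ) * z}

/-- The shortest Euclidean distance `δ'(z, (a, b))` from `a + bω` to the half-line `ℓ(z)`. -/
def rayDist (z : ℂ) (p : ℕ × ℕ) : ENNReal := Metric.infEDist (eisensteinPoint p) (halfLine z)

/-- `δ(z) = liminf δ'(z, (a, b))`, a number in `[0, ∞]`, where `(a, b)` runs over the Eisenstein
pairs ordered by the absolute value `|a + bω|`. -/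
def eisensteinDelta (z : ℂ) : ENNReal :=
  liminf (fun p : {p : ℕ × ℕ // IsEisensteinPair p} => rayDist z p.1)
    (comap (fun p : {p : ℕ × ℕ // IsEisensteinPair p} => ‖eisensteinPoint p.1‖) atTop)

/-- The set of real numbers `{δ(z) : |z| = 1, δ(z) < ∞}`. -/
def eisensteinDeltaSet : Set ℝ :=
  {x | ∃ z : ℂ, ‖z‖ = 1 ∧ eisensteinDelta z < ⊤ ∧ x = (eisensteinDelta z).toReal}

end

/-!
The Eisenstein pairs are the positive multiples of the values of two binary quadratic maps at
`(p, q)`, and their distances from a half-line are, up to the factor `√3`, the values of an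
indefinite binary form with a root at `t`, respectively at `3 * t`, for a parameter `t` of the
half-line. So `δ` is a Lagrange constant of `t` taken over two lattices at once. The constant of the
pair of forms depends only on the tail of a continued-fraction-like coding of `t` by the two moves
`bend` and `straight`, and a pair of forms corresponds to a future and a past of the coding. If all
values are at least `1 / 4`, the moves are eventually all `bend`, or all `straight`, or the coding
is periodic, consisting of blocks of equally many `bend` moves, an even number, separated by single
`straight` moves. The constants of the periodic codings tend to `√3 / 4` from above as the blocks
grow.
-/

section ApproxBound

/-- `c` is a lower bound for all but finitely many of the approximation constants `q |p - τ q|` of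
`τ`; the supremum of such `c` is the Lagrange (or Markov) constant of `τ`. -/
def ApproxBound (τ c : ℝ) : Prop := ∀ᶠ q : ℕ in atTop, ∀ p : ℤ, c ≤ q * |(p : ℝ) - τ * q|

variable {τ ν c c' : ℝ}

lemma ApproxBound.mono (h : ApproxBound τ c) (hc : c' ≤ c) : ApproxBound τ c' :=
  Eventually.mono h fun _ hq p => hc.trans (hq p)

lemma ApproxBound.neg (h : ApproxBound τ c) : ApproxBound (-τ) c := by
  refine Eventually.mono h fun q hq p => (hq (-p)).trans_eq ?_
  rw [← abs_neg]
  push_cast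
  ring_nf

lemma ApproxBound.add_int (h : ApproxBound τ c) (n : ℤ) : ApproxBound (τ + n) c := by
  refine Eventually.mono h fun q hq p => (hq (p - n * q)).trans_eq ?_
  push_cast
  ring_nf

lemma ApproxBound.irrational (hc : 0 < c) (h : ApproxBound τ c) : Irrational τ := by
  rintro ⟨r, rfl⟩
  obtain ⟨K, hK⟩ := eventually_atTop.1 h
  have hle := hK ((K + 1) * r.den) (by nlinarith [r.pos]) ((K + 1) * r.num)
  have hzero : (((K + 1) * r.num : ℤ) : ℝ) - r * (((K + 1) * r.den : ℕ) : ℝ) = 0 := by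
    have hr : (r : ℝ) * r.den = r.num := by exact_mod_cast Rat.mul_den_eq_num r
    push_cast
    linear_combination (-(K + 1 : ℝ)) * hr
  rw [hzero, abs_zero, mul_zero] at hle
  exact hc.not_ge hle

/-- The absolute value at `(p, q)` of the indefinite binary quadratic form with roots `τ` and
`-1/ν`, normalized to discriminant one. -/
noncomputable def formValue (τ ν : ℝ) (p q : ℕ) : ℝ :=
  |(p : ℝ) - τ * q| * (ν * p + q) / (τ * ν + 1)

lemma formValue_moebius {a b c d : ℕ} (hdet : |(a * d - b * c : ℝ)| = 1) (hτ : 0 < c * τ + d)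
    (hν : 0 < b * ν + d) (p q : ℕ) :
    formValue ((a * τ + b) / (c * τ + d)) ν (a * p + b * q) (c * p + d * q) =
      formValue τ ((a * ν + c) / (b * ν + d)) p q := by
  have hleft : ((a * p + b * q : ℕ) : ℝ) - (a * τ + b) / (c * τ + d) * (c * p + d * q : ℕ)
      = (a * d - b * c) * (p - τ * q) / (c * τ + d) := by
    rw [eq_div_iff hτ.ne', sub_mul, mul_right_comm, div_mul_cancel₀ _ hτ.ne']
    push_cast
    ring
  have hright : ν * (a * p + b * q : ℕ) + (c * p + d * q : ℕ)
      = (b * ν + d) * ((a * ν + c) / (b * ν + d) * p + q) := by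
    rw [mul_add, ← mul_assoc, mul_div_cancel₀ _ hν.ne']
    push_cast
    ring
  have hdisc : (a * τ + b) / (c * τ + d) * ν + 1
      = (b * ν + d) * (τ * ((a * ν + c) / (b * ν + d)) + 1) / (c * τ + d) := by
    rw [mul_add, mul_left_comm, mul_div_cancel₀ _ hν.ne', eq_div_iff hτ.ne', add_mul,
      mul_right_comm, div_mul_cancel₀ _ hτ.ne']
    ring
  rw [formValue, hleft, hright, hdisc, abs_div, abs_mul, hdet, one_mul, abs_of_pos hτ,
    div_mul_eq_mul_div, div_div_div_cancel_right₀ hτ.ne', mul_left_comm,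
    mul_div_mul_left _ _ hν.ne', formValue]

lemma formValue_inv_inv (hτ : 0 < τ) (hν : 0 < ν) (p q : ℕ) :
    formValue τ⁻¹ ν⁻¹ q p = formValue τ ν p q := by
  have hleft : (q : ℝ) - τ⁻¹ * p = -(p - τ * q) / τ := by field_simp; ring
  rw [formValue, formValue, hleft, abs_div, abs_neg, abs_of_pos hτ]
  field_simp
  ring

/-- Where the linear factor `p - τ q` is small, the form agrees with `q |p - τ q|` up to a
quadratically small error. -/
lemma abs_formValue_sub_le (hτ : 0 < τ) (hν : 0 ≤ ν) (p q : ℕ) :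
    |formValue τ ν p q - (q * |(p : ℝ) - τ * q|)| ≤ ((p : ℝ) - τ * q) ^ 2 / τ := by
  set x := (p : ℝ) - τ * q with hx
  have hdisc : 0 < τ * ν + 1 := by positivity
  have hp : (p : ℝ) = x + τ * q := by rw [hx]; ring
  have herror : formValue τ ν p q - q * |x| = ν * (|x| * x) / (τ * ν + 1) := by
    rw [formValue, ← hx, hp]
    field_simp
    ring
  rw [herror, abs_div, abs_mul, abs_mul, abs_abs, abs_mul_abs_self, abs_of_pos hdisc,
    abs_of_nonneg hν, div_le_div_iff₀ hdisc hτ]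
  nlinarith [mul_self_nonneg x]

lemma abs_formValue_sub_le_of_abs_lt (hτ : 0 < τ) (hν : 0 ≤ ν) {ε : ℝ} {p q : ℕ}
    (h : |(p : ℝ) - τ * q| < min 1 (ε * τ)) :
    |formValue τ ν p q - (q * |(p : ℝ) - τ * q|)| ≤ ε := by
  refine (abs_formValue_sub_le hτ hν p q).trans ((div_le_iff₀ hτ).2 ?_)
  obtain ⟨hone, hε⟩ := lt_min_iff.1 h
  calc ((p : ℝ) - τ * q) ^ 2 = |(p : ℝ) - τ * q| * |(p : ℝ) - τ * q| := by rw [← sq, sq_abs]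
    _ ≤ |(p : ℝ) - τ * q| * 1 := mul_le_mul_of_nonneg_left hone.le (abs_nonneg _)
    _ ≤ ε * τ := by rw [mul_one]; exact hε.le

lemma ApproxBound.exists_le_formValue (h : ApproxBound τ c) (hτ : 0 < τ) (hν : 0 < ν)
    (hc : c' < c) : ∃ K : ℕ, ∀ p q : ℕ, K ≤ p + q → c' ≤ formValue τ ν p q := by
  set ε := min 1 ((c - c') * τ)
  have hε : 0 < ε := lt_min one_pos (mul_pos (sub_pos.2 hc) hτ)
  set m := min ν 1
  have hm : 0 < m := lt_min hν one_pos
  obtain ⟨Q, hQ⟩ := eventually_atTop.1 h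
  obtain ⟨K, hK⟩ := exists_nat_gt (max (c' * (τ * ν + 1) / (ε * m)) (1 + (τ + 1) * Q))
  refine ⟨K, fun p q hpq => ?_⟩
  have hlarge := hK.trans_le (by exact_mod_cast hpq : (K : ℝ) ≤ p + q)
  obtain ⟨hform, hindex⟩ := max_lt_iff.1 hlarge
  rcases lt_or_ge |(p : ℝ) - τ * q| ε with hx | hx
  · have hq : Q ≤ q := by
      have hx1 := (abs_lt.1 (hx.trans_le (min_le_left _ _))).2
      have : (τ + 1) * (Q : ℝ) ≤ (τ + 1) * q := by linarith
      exact_mod_cast le_of_mul_le_mul_left this (by positivity)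
    have hbound := hQ q hq p
    have herror := (abs_le.1 (abs_formValue_sub_le_of_abs_lt hτ hν.le hx)).1
    push_cast at hbound
    linarith
  · have hfactor : m * (p + q) ≤ ν * p + q := by
      nlinarith [min_le_left ν 1, min_le_right ν 1, p.cast_nonneg (α := ℝ), q.cast_nonneg (α := ℝ)]
    rw [div_lt_iff₀ (mul_pos hε hm)] at hform
    rw [formValue, le_div_iff₀ (by positivity)]
    calc c' * (τ * ν + 1) ≤ ε * (m * (p + q)) := by linarith
      _ ≤ |(p : ℝ) - τ * q| * (ν * p + q) :=
        mul_le_mul hx hfactor (by positivity) (abs_nonneg _)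

lemma approxBound_of_le_formValue (hτ : 0 < τ) (hν : 0 ≤ ν) (hc : c' < c)
    (h : ∀ᶠ q : ℕ in atTop, ∀ p : ℕ, 0 < p → c ≤ formValue τ ν p q) : ApproxBound τ c' := by
  set ε := min 1 ((c - c') * τ)
  have hε : 0 < ε := lt_min one_pos (mul_pos (sub_pos.2 hc) hτ)
  filter_upwards [h, tendsto_natCast_atTop_atTop.eventually_ge_atTop (max (c' / ε) (1 / τ))]
    with q hq hlarge p
  obtain ⟨hfar, hnear⟩ := max_le_iff.1 hlarge
  rcases lt_or_ge |(p : ℝ) - τ * q| ε with hx | hx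
  · have hp : 0 < p := by
      have hx1 := (abs_lt.1 (hx.trans_le (min_le_left _ _))).1
      rw [div_le_iff₀ hτ] at hnear
      exact_mod_cast (by linarith : (0 : ℝ) < p)
    lift p to ℕ using hp.le
    have hbound := hq p (by exact_mod_cast hp)
    have herror := (abs_le.1 (abs_formValue_sub_le_of_abs_lt hτ hν hx)).2
    push_cast
    linarith
  · calc c' ≤ q * ε := (div_le_iff₀ hε).1 hfar
      _ ≤ q * |(p : ℝ) - τ * q| := mul_le_mul_of_nonneg_left hx q.cast_nonneg

lemma ApproxBound.inv (h : ApproxBound τ c) (hτ : 0 < τ) (hc : c' < c) :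
    ApproxBound τ⁻¹ c' := by
  obtain ⟨c₁, hc₁', hc₁⟩ := exists_between hc
  obtain ⟨K, hK⟩ := h.exists_le_formValue hτ one_pos hc₁
  refine approxBound_of_le_formValue (ν := 1) (inv_pos.2 hτ) zero_le_one hc₁' ?_
  filter_upwards [eventually_ge_atTop K] with q hq p _
  have hmirror := formValue_inv_inv hτ one_pos q p
  rw [inv_one] at hmirror
  exact (hK q p (by omega)).trans_eq hmirror.symm

end ApproxBound

section LagrangeValue

variable {t t' c c' s : ℝ} {X : ENNReal}

/-- `c` is a lower bound for almost all approximation constants of `t` and of `3 t`: the two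
families of Eisenstein pairs correspond to approximations of `t` and of `3 t`. -/
def BiApproxBound (t c : ℝ) : Prop := ApproxBound t c ∧ ApproxBound (3 * t) c

lemma BiApproxBound.mono (h : BiApproxBound t c) (hc : c' ≤ c) : BiApproxBound t c' :=
  ⟨h.1.mono hc, h.2.mono hc⟩

/-- The joint Lagrange constant of `t` and `3 t`, scaled by `√3` so that it equals `eisensteinDelta`
in the direction with parameter `t`. -/
noncomputable def lagrangeValue (t : ℝ) : ENNReal :=
  ⨆ (c : ℝ) (_ : BiApproxBound t c), ENNReal.ofReal (√3 * c)

lemma ofReal_mul_le_of_forall_lt (h : ∀ c' < c, ENNReal.ofReal (s * c') ≤ X) :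
    ENNReal.ofReal (s * c) ≤ X :=
  have hcont : Continuous fun c' : ℝ => ENNReal.ofReal (s * c') :=
    ENNReal.continuous_ofReal.comp (continuous_const_mul s)
  le_of_tendsto (hcont.tendsto c |>.mono_left nhdsWithin_le_nhds) <|
    eventually_nhdsWithin_of_forall (s := Set.Iio c) h

lemma BiApproxBound.ofReal_le_lagrangeValue (h : BiApproxBound t c) :
    ENNReal.ofReal (√3 * c) ≤ lagrangeValue t :=
  le_iSup₂_of_le c h le_rfl

lemma lagrangeValue_le_of_forall_lt
    (h : ∀ c c', c' < c → BiApproxBound t c → ENNReal.ofReal (√3 * c') ≤ X) :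
    lagrangeValue t ≤ X :=
  iSup₂_le fun c hc => ofReal_mul_le_of_forall_lt fun c' hc' => h c c' hc' hc

lemma lagrangeValue_le_lagrangeValue
    (h : ∀ c c', c' < c → BiApproxBound t c → BiApproxBound t' c') :
    lagrangeValue t ≤ lagrangeValue t' :=
  lagrangeValue_le_of_forall_lt fun c c' hc ht => (h c c' hc ht).ofReal_le_lagrangeValue

lemma exists_biApproxBound_of_lt (h : ENNReal.ofReal (√3 * c) < lagrangeValue t) :
    ∃ c', c < c' ∧ BiApproxBound t c' := by
  simp only [lagrangeValue, lt_iSup_iff] at h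
  obtain ⟨c', hc', hlt⟩ := h
  refine ⟨c', lt_of_not_ge fun hle => hlt.not_ge ?_, hc'⟩
  gcongr

lemma lagrangeValue_neg (t : ℝ) : lagrangeValue (-t) = lagrangeValue t := by
  have key (t : ℝ) : lagrangeValue t ≤ lagrangeValue (-t) :=
    lagrangeValue_le_lagrangeValue fun c c' hc h =>
      BiApproxBound.mono ⟨h.1.neg, by rw [mul_neg]; exact h.2.neg⟩ hc.le
  exact le_antisymm ((key (-t)).trans_eq (by rw [neg_neg])) (key t)

lemma lagrangeValue_add_int (t : ℝ) (n : ℤ) : lagrangeValue (t + n) = lagrangeValue t := by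
  have key (t : ℝ) (n : ℤ) : lagrangeValue t ≤ lagrangeValue (t + n) :=
    lagrangeValue_le_lagrangeValue fun c c' hc h =>
      BiApproxBound.mono ⟨h.1.add_int n, by
        have := h.2.add_int (3 * n)
        push_cast at this
        rwa [mul_add]⟩ hc.le
  refine le_antisymm ((key (t + n) (-n)).trans_eq ?_) (key t n)
  rw [Int.cast_neg, add_neg_cancel_right]

lemma lagrangeValue_add_one (t : ℝ) : lagrangeValue (t + 1) = lagrangeValue t := by
  exact_mod_cast lagrangeValue_add_int t 1

lemma lagrangeValue_mirror (ht : 0 < t) : lagrangeValue (3 * t)⁻¹ = lagrangeValue t := by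
  have key {t : ℝ} (ht : 0 < t) : lagrangeValue t ≤ lagrangeValue (3 * t)⁻¹ :=
    lagrangeValue_le_lagrangeValue fun c c' hc h =>
      ⟨h.2.inv (by positivity) hc, by
        rw [mul_inv, mul_inv_cancel_left₀ three_ne_zero]
        exact h.1.inv ht hc⟩
  refine le_antisymm ((key (by positivity)).trans_eq ?_) (key ht)
  congr 1
  field_simp

end LagrangeValue

section Moves

variable {a b c d : ℕ} {t v x y : ℝ}

lemma lagrangeValue_one_sub (t : ℝ) : lagrangeValue (1 - t) = lagrangeValue t := by
  rw [sub_eq_neg_add, lagrangeValue_add_one, lagrangeValue_neg]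

lemma lagrangeValue_div_three_mul_add_one (ht : 0 < t) :
    lagrangeValue (t / (3 * t + 1)) = lagrangeValue t := by
  rw [← lagrangeValue_mirror (by positivity), ← lagrangeValue_mirror ht,
    ← lagrangeValue_add_one (3 * t)⁻¹]
  congr 1
  field_simp
  ring

/-- The Möbius transformation with matrix `!![a, b; 3 * c, d]`. Transposing it as a transformation
of the lattice of `3 t` interchanges `b` and `c`. -/
noncomputable def move (a b c d : ℕ) (x : ℝ) : ℝ := (a * x + b) / (3 * c * x + d)

lemma move_pos (ha : 0 < a) (hd : 0 < d) (hx : 0 < x) : 0 < move a b c d x := by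
  unfold move
  positivity

lemma formValue_move_left (hdet : |(a * d - 3 * b * c : ℝ)| = 1) (hd : 0 < d) (ht : 0 < t)
    (hv : 0 < v) (p q : ℕ) :
    formValue (move a b c d t) (3 * v) (a * p + b * q) (3 * c * p + d * q) =
      formValue t (3 * move a c b d v) p q := by
  have h := formValue_moebius (a := a) (b := b) (c := 3 * c) (d := d) (τ := t) (ν := 3 * v)
    (by rw [← hdet]; push_cast; ring_nf) (by positivity) (by positivity) p q
  convert h using 2
  · unfold move
    push_cast
    ring
  · unfold move
    push_cast
    rw [← mul_div_assoc]
    ring_nf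

lemma formValue_move_right (hdet : |(a * d - 3 * b * c : ℝ)| = 1) (hd : 0 < d) (ht : 0 < t)
    (hv : 0 < v) (p q : ℕ) :
    formValue (3 * move a b c d t) v (a * p + 3 * b * q) (c * p + d * q) =
      formValue (3 * t) (move a c b d v) p q := by
  have h := formValue_moebius (a := a) (b := 3 * b) (c := c) (d := d) (τ := 3 * t) (ν := v)
    (by rw [← hdet]; push_cast; ring_nf) (by positivity) (by positivity) p q
  convert h using 2
  · unfold move
    rw [← mul_div_assoc]
    push_cast
    ring_nf
  · unfold move
    push_cast
    ring

/-- The move of the coding that maps `(0, ∞)` onto `(2 / 3, 1)`; it preserves `lagrangeValue`. -/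
noncomputable def bend : ℝ → ℝ := move 2 1 1 1

/-- The move of the coding that maps `(0, ∞)` onto `(1 / 2, 2 / 3)`; it preserves
`lagrangeValue`. -/
noncomputable def straight : ℝ → ℝ := move 2 1 1 2

lemma bend_eq (x : ℝ) : bend x = (2 * x + 1) / (3 * x + 1) := by
  norm_num [bend, move]

lemma straight_eq (x : ℝ) : straight x = (2 * x + 1) / (3 * x + 2) := by
  norm_num [straight, move]

lemma bend_pos (hx : 0 < x) : 0 < bend x := move_pos two_pos one_pos hx

lemma straight_pos (hx : 0 < x) : 0 < straight x := move_pos two_pos two_pos hx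

lemma lagrangeValue_bend (hx : 0 < x) : lagrangeValue (bend x) = lagrangeValue x := by
  have hbend : bend x = 1 - x / (3 * x + 1) := by
    rw [bend_eq]
    field_simp
    ring
  rw [hbend, lagrangeValue_one_sub, lagrangeValue_div_three_mul_add_one hx]

lemma lagrangeValue_straight (hx : 0 < x) : lagrangeValue (straight x) = lagrangeValue x := by
  have hstraight : straight x = 1 - (3 * (1 - (3 * (x + 1))⁻¹))⁻¹ := by
    have hinner : 1 - (3 * (x + 1))⁻¹ = (3 * x + 2) / (3 * (x + 1)) := by field_simp; ring
    rw [straight_eq, hinner]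
    field_simp
    ring
  have hinner : 0 < 1 - (3 * (x + 1))⁻¹ := sub_pos.2 (inv_lt_one_of_one_lt₀ (by linarith))
  rw [hstraight, lagrangeValue_one_sub, lagrangeValue_mirror hinner, lagrangeValue_one_sub,
    lagrangeValue_mirror (by positivity), lagrangeValue_add_one]

lemma exists_bend_eq (h₁ : 2 / 3 < y) (h₂ : y < 1) : ∃ x, 0 < x ∧ bend x = y := by
  have hden : 0 < 3 * y - 2 := by linarith
  refine ⟨(1 - y) / (3 * y - 2), div_pos (by linarith) hden, ?_⟩
  have hx : 3 * ((1 - y) / (3 * y - 2)) + 1 = 1 / (3 * y - 2) := by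
    rw [← mul_div_assoc, div_add_one hden.ne']
    ring
  rw [bend_eq, hx, div_div_eq_mul_div, add_mul, ← mul_div_assoc, div_mul_cancel₀ _ hden.ne']
  ring

lemma exists_straight_eq (h₁ : 1 / 2 < y) (h₂ : y < 2 / 3) : ∃ x, 0 < x ∧ straight x = y := by
  have hden : 0 < 2 - 3 * y := by linarith
  refine ⟨(2 * y - 1) / (2 - 3 * y), div_pos (by linarith) hden, ?_⟩
  have hx : 3 * ((2 * y - 1) / (2 - 3 * y)) + 2 = 1 / (2 - 3 * y) := by
    rw [← mul_div_assoc, div_add' _ _ _ hden.ne']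
    ring
  rw [straight_eq, hx, div_div_eq_mul_div, add_mul, ← mul_div_assoc, div_mul_cancel₀ _ hden.ne']
  ring

end Moves

section FormBound

variable {a b c d K : ℕ} {t v κ κ' : ℝ} {S T : Set (ℕ × ℕ)} {y : ENNReal}

/-- The forms of the state `(t, v)` on the two lattices take values at least `κ` on `S`. -/
structure FormBoundOn (κ : ℝ) (S : Set (ℕ × ℕ)) (t v : ℝ) : Prop where
  pos_left : 0 < t
  pos_right : 0 < v
  le_left : ∀ p q, (p, q) ∈ S → κ ≤ formValue t (3 * v) p q
  le_right : ∀ p q, (p, q) ∈ S → κ ≤ formValue (3 * t) v p q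

/-- The forms of the state `(t, v)` take values at least `κ` at the points of the positive quadrant
whose coordinate sum exceeds `K`. -/
abbrev FormBound (κ : ℝ) (K : ℕ) : ℝ → ℝ → Prop := FormBoundOn κ {x | K < x.1 + x.2}

lemma FormBoundOn.mono (h : FormBoundOn κ S t v) (hT : T ⊆ S) : FormBoundOn κ T t v :=
  ⟨h.pos_left, h.pos_right, fun p q hpq => h.le_left p q (hT hpq),
    fun p q hpq => h.le_right p q (hT hpq)⟩

lemma FormBoundOn.of_move (h : FormBoundOn κ S (move a b c d t) v) (ht : 0 < t)
    (hdet : |(a * d - 3 * b * c : ℝ)| = 1) (ha : 0 < a) (hd : 0 < d)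
    (hS : ∀ p q, (p, q) ∈ T →
      (a * p + b * q, 3 * c * p + d * q) ∈ S ∧ (a * p + 3 * b * q, c * p + d * q) ∈ S) :
    FormBoundOn κ T t (move a c b d v) where
  pos_left := ht
  pos_right := move_pos ha hd h.pos_right
  le_left p q hpq :=
    (h.le_left _ _ (hS p q hpq).1).trans_eq (formValue_move_left hdet hd ht h.pos_right p q)
  le_right p q hpq :=
    (h.le_right _ _ (hS p q hpq).2).trans_eq (formValue_move_right hdet hd ht h.pos_right p q)

lemma FormBound.of_bend (h : FormBound κ K (bend t) v) (ht : 0 < t) :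
    FormBound κ (K - 1) t (bend v) :=
  h.of_move ht (by norm_num) two_pos one_pos fun p q hpq => by
    simp only [Set.mem_ofPred_eq] at hpq ⊢
    omega

lemma FormBound.of_straight (h : FormBound κ K (straight t) v) (ht : 0 < t) :
    FormBound κ (K - 1) t (straight v) :=
  h.of_move ht (by norm_num) two_pos two_pos fun p q hpq => by
    simp only [Set.mem_ofPred_eq] at hpq ⊢
    omega

lemma FormBoundOn.of_add_one (h : FormBoundOn κ S (t + 1) v) (ht : 0 < t)
    (hS : ∀ p q, (p, q) ∈ T → (p + q, q) ∈ S ∧ (p + 3 * q, q) ∈ S) :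
    FormBoundOn κ T t (v / (3 * v + 1)) := by
  have hmove : FormBoundOn κ T t (move 1 0 1 1 v) :=
    FormBoundOn.of_move (a := 1) (b := 1) (c := 0) (d := 1) (S := S)
      (by simpa [move] using h) ht (by norm_num) one_pos one_pos (by simpa using hS)
  simpa [move] using hmove

lemma FormBoundOn.of_div_three_mul_add_one (h : FormBoundOn κ S (t / (3 * t + 1)) v) (ht : 0 < t)
    (hS : ∀ p q, (p, q) ∈ T → (p, 3 * p + q) ∈ S ∧ (p, p + q) ∈ S) :
    FormBoundOn κ T t (v + 1) := by
  have hmove : FormBoundOn κ T t (move 1 1 0 1 v) :=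
    FormBoundOn.of_move (a := 1) (b := 0) (c := 1) (d := 1) (S := S)
      (by simpa [move] using h) ht (by norm_num) one_pos one_pos (by simpa using hS)
  simpa [move] using hmove

lemma FormBound.mirror (h : FormBound κ K t v) : FormBound κ K (3 * t)⁻¹ (3 * v)⁻¹ := by
  obtain ⟨ht, hv, hleft, hright⟩ := h
  have hmul {x : ℝ} : 3 * (3 * x)⁻¹ = x⁻¹ := by field_simp
  refine ⟨by positivity, by positivity, fun p q hpq => ?_, fun p q hpq => ?_⟩
  · rw [hmul, formValue_inv_inv (by positivity) hv]
    exact hright q p (by simpa [add_comm] using hpq)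
  · rw [hmul, formValue_inv_inv ht (by positivity)]
    exact hleft q p (by simpa [add_comm] using hpq)

lemma BiApproxBound.exists_formBound (h : BiApproxBound t κ) (ht : 0 < t) (hv : 0 < v)
    (hκ : κ' < κ) : ∃ K, FormBound κ' K t v := by
  obtain ⟨K, hK⟩ := h.1.exists_le_formValue (ν := 3 * v) ht (by positivity) hκ
  obtain ⟨L, hL⟩ := h.2.exists_le_formValue (ν := v) (by positivity) hv hκ
  refine ⟨max K L, ht, hv, fun p q hpq => hK p q ?_, fun p q hpq => hL p q ?_⟩ <;>
  · simp only [Set.mem_ofPred_eq] at hpq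
    omega

lemma FormBound.biApproxBound (h : FormBound κ K t v) (hκ : κ' < κ) : BiApproxBound t κ' := by
  obtain ⟨ht, hv, hleft, hright⟩ := h
  refine ⟨approxBound_of_le_formValue (ν := 3 * v) ht (by positivity) hκ ?_,
    approxBound_of_le_formValue (ν := v) (by positivity) hv.le hκ ?_⟩ <;>
  filter_upwards [eventually_ge_atTop K] with q hq p hp
  · exact hleft p q (by simp only [Set.mem_ofPred_eq]; omega)
  · exact hright p q (by simp only [Set.mem_ofPred_eq]; omega)

lemma FormBound.irrational (h : FormBound κ K t v) (hκ : 0 < κ) : Irrational t :=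
  (h.biApproxBound (half_lt_self hκ)).1.irrational (half_pos hκ)

/-- The value `y` is attained by a state whose forms are bounded below outside a triangle of
size `K`. -/
def HasState (κ : ℝ) (K : ℕ) (y : ENNReal) : Prop :=
  ∃ t v, lagrangeValue t = y ∧ FormBound κ K t v

lemma FormBound.hasState_of_two_thirds_lt (h : FormBound κ (K + 1) t v) (h₁ : 2 / 3 < t)
    (h₂ : t < 1) : HasState κ K (lagrangeValue t) := by
  obtain ⟨x, hx, rfl⟩ := exists_bend_eq h₁ h₂
  exact ⟨x, bend v, (lagrangeValue_bend hx).symm, h.of_bend hx⟩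

lemma FormBound.hasState_of_mem_Ioo (h : FormBound κ (K + 1) t v) (hκ : 0 < κ) (h₁ : 1 / 3 < t)
    (h₂ : t < 1) : HasState κ K (lagrangeValue t) := by
  have hirr := h.irrational hκ
  have hne_two_thirds : t ≠ 2 / 3 := by simpa using hirr.ne_rat (2 / 3)
  have hne_half : t ≠ 1 / 2 := by simpa using hirr.ne_rat (1 / 2)
  rcases hne_two_thirds.lt_or_gt with hlt | hgt
  · rcases hne_half.lt_or_gt with hlt' | hgt'
    · rw [← lagrangeValue_mirror h.pos_left]
      refine h.mirror.hasState_of_two_thirds_lt ?_ (inv_lt_one_of_one_lt₀ (by linarith))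
      rw [lt_inv_comm₀ (by norm_num) (mul_pos three_pos h.pos_left)]
      linarith
    · obtain ⟨x, hx, rfl⟩ := exists_straight_eq hgt' hlt
      exact ⟨x, straight v, (lagrangeValue_straight hx).symm, h.of_straight hx⟩
  · exact h.hasState_of_two_thirds_lt hgt h₂

/-- The exceptional set reached after a unit translation: it no longer asks anything of the
multiples of `(1, 0)` on the boundary of the triangle, and is stable under further translations. -/
def shiftedSet (K : ℕ) : Set (ℕ × ℕ) := {x | K + 1 < x.1 + x.2 ∨ 0 < x.2 ∧ K < x.1 + x.2}

lemma FormBoundOn.hasState_of_shiftedSet (hκ : 0 < κ) (n : ℕ) :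
    ∀ {t v : ℝ}, t < n → FormBoundOn κ (shiftedSet K) t v → HasState κ K (lagrangeValue t) := by
  induction n with
  | zero => exact fun ht h => absurd h.pos_left (by simpa using ht.le)
  | succ n ih =>
    intro t v hn h
    have hbound : FormBound κ (K + 1) t v := h.mono fun _ => Or.inl
    have hirr := hbound.irrational hκ
    have hne_third : t ≠ 1 / 3 := by simpa using hirr.ne_rat (1 / 3)
    push_cast at hn
    rcases hirr.ne_one.lt_or_gt with hlt | hgt
    · rcases hne_third.lt_or_gt with hlt' | hgt'
      · have hden : 0 < 1 - 3 * t := by linarith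
        have ht := h.pos_left
        obtain ⟨x, hx, rfl⟩ : ∃ x, 0 < x ∧ x / (3 * x + 1) = t := by
          refine ⟨t / (1 - 3 * t), div_pos ht hden, ?_⟩
          rw [← mul_div_assoc, div_add_one hden.ne', div_div_div_cancel_right₀ hden.ne',
            add_sub_cancel, div_one]
        refine ⟨x, v + 1, (lagrangeValue_div_three_mul_add_one hx).symm,
          h.of_div_three_mul_add_one hx fun p q hpq => ?_⟩
        simp only [shiftedSet, Set.mem_ofPred_eq] at hpq ⊢
        omega
      · exact hbound.hasState_of_mem_Ioo hκ hgt' hlt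
    · rw [← sub_add_cancel t 1, lagrangeValue_add_one]
      refine ih (by linarith) <| FormBoundOn.of_add_one (S := shiftedSet K)
        (by rwa [sub_add_cancel]) (by linarith) fun p q hpq => ?_
      simp only [shiftedSet, Set.mem_ofPred_eq] at hpq ⊢
      omega

lemma FormBound.hasState_of_one_lt (h : FormBound κ (K + 1) t v) (hκ : 0 < κ) (ht : 1 < t) :
    HasState κ K (lagrangeValue t) := by
  obtain ⟨n, hn⟩ := exists_nat_gt (t - 1)
  rw [← sub_add_cancel t 1, lagrangeValue_add_one]
  refine FormBoundOn.hasState_of_shiftedSet hκ n hn <|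
    FormBoundOn.of_add_one (S := {x | K + 1 < x.1 + x.2}) (by rwa [sub_add_cancel]) (by linarith)
      fun p q hpq => ?_
  simp only [shiftedSet, Set.mem_ofPred_eq] at hpq ⊢
  omega

lemma HasState.of_succ (h : HasState κ (K + 1) y) (hκ : 0 < κ) : HasState κ K y := by
  obtain ⟨t, v, rfl, h⟩ := h
  have hirr := h.irrational hκ
  have hne_third : t ≠ 1 / 3 := by simpa using hirr.ne_rat (1 / 3)
  rcases hirr.ne_one.lt_or_gt with hlt | hgt
  · rcases hne_third.lt_or_gt with hlt' | hgt'
    · have ht := h.pos_left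
      rw [← lagrangeValue_mirror ht]
      exact h.mirror.hasState_of_one_lt hκ ((one_lt_inv₀ (by positivity)).2 (by linarith))
    · exact h.hasState_of_mem_Ioo hκ hgt' hlt
  · exact h.hasState_of_one_lt hκ hgt

lemma HasState.of_any (h : HasState κ K y) (hκ : 0 < κ) : HasState κ 0 y := by
  induction K with
  | zero => exact h
  | succ K ih => exact ih (h.of_succ hκ)

lemma hasState_zero_of_lt (ht : 0 < t) (hκ : 0 < κ)
    (h : ENNReal.ofReal (√3 * κ) < lagrangeValue t) : HasState κ 0 (lagrangeValue t) := by
  obtain ⟨κ', hlt, hκ'⟩ := exists_biApproxBound_of_lt h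
  obtain ⟨K, hK⟩ := hκ'.exists_formBound ht one_pos hlt
  exact HasState.of_any ⟨t, 1, rfl, hK⟩ hκ

end FormBound

section GoodState

variable {t v κ x y : ℝ}

lemma FormBound.mul_le_left (h : FormBound κ 0 t v) : κ * (3 * t * v + 1) ≤ t := by
  obtain ⟨ht, hv, hleft, -⟩ := h
  have hvalue := hleft 0 1 (by simp)
  rw [formValue, le_div_iff₀ (by positivity)] at hvalue
  norm_num [abs_of_pos ht] at hvalue
  linarith

lemma FormBound.mul_le_right (h : FormBound κ 0 t v) : κ * (3 * t * v + 1) ≤ v := by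
  obtain ⟨ht, hv, -, hright⟩ := h
  have hvalue := hright 1 0 (by simp)
  rw [formValue, le_div_iff₀ (by positivity)] at hvalue
  simpa using hvalue

/-- The forms of the state `(t, v)` are at least `1 / 4` on the whole positive quadrant. Values of
`eisensteinDelta` above `√3 / 4` come from such states. -/
abbrev IsGood (t v : ℝ) : Prop := FormBound (1 / 4) 0 t v

lemma IsGood.mirror (h : IsGood t v) : IsGood (3 * t)⁻¹ (3 * v)⁻¹ := FormBound.mirror h

lemma IsGood.irrational (h : IsGood t v) : Irrational t :=
  FormBound.irrational h (by norm_num)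

lemma IsGood.ne_half (h : IsGood t v) : t ≠ 1 / 2 := by simpa using h.irrational.ne_rat (1 / 2)

lemma IsGood.ne_two_thirds (h : IsGood t v) : t ≠ 2 / 3 := by
  simpa using h.irrational.ne_rat (2 / 3)

lemma IsGood.left_lt_one (h : IsGood t v) : t < 1 := by
  have hv := h.pos_right
  have hleft := h.mul_le_left
  have hright := h.mul_le_right
  refine lt_of_not_ge fun hge => ?_
  have hgt : 0 < t - 1 := sub_pos.2 (hge.lt_of_ne h.irrational.ne_one.symm)
  have hshift : IsGood (t - 1) (v / (3 * v + 1)) :=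
    FormBoundOn.of_add_one (S := {x | 0 < x.1 + x.2}) (by rwa [sub_add_cancel]) hgt
      fun p q hpq => by
        simp only [Set.mem_ofPred_eq] at hpq ⊢
        omega
  have ht : 5 / 4 ≤ t := by
    have := mul_pos hgt hshift.pos_right
    have := hshift.mul_le_left
    linarith
  have : 4 ≤ v := by nlinarith
  nlinarith

lemma IsGood.third_lt_left (h : IsGood t v) : 1 / 3 < t := by
  have hmirror := h.mirror.left_lt_one
  rw [inv_lt_one₀ (mul_pos three_pos h.pos_left)] at hmirror
  linarith

lemma IsGood.right_lt_one (h : IsGood t v) : v < 1 := by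
  have ht := h.left_lt_one
  have hleft := h.mul_le_left
  by_contra! hge
  have := mul_le_mul_of_nonneg_left hge h.pos_left.le
  linarith

lemma IsGood.left_lt_two_thirds (h : IsGood t v) (hv : v ≤ 7 / 12) : t < 2 / 3 := by
  refine lt_of_not_ge fun hge => ?_
  obtain ⟨x, hx, rfl⟩ := exists_bend_eq (hge.lt_of_ne h.ne_two_thirds.symm) h.left_lt_one
  have hgood : IsGood x (bend v) := h.of_bend hx
  have hx_ge : 5 / 6 ≤ x := by
    have hvalue := h.mul_le_right
    have hbend : bend x ≤ 16 / 21 := by nlinarith [h.pos_right]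
    rw [bend_eq, div_le_iff₀ (by positivity)] at hbend
    linarith
  obtain ⟨y, hy, rfl⟩ := exists_bend_eq (by linarith) hgood.left_lt_one
  have hy_gt := (show IsGood y _ from hgood.of_bend hy).third_lt_left
  rw [bend_eq, le_div_iff₀ (by positivity)] at hx_ge
  linarith

lemma IsGood.half_lt_left (h : IsGood t v) (hv : 4 / 7 ≤ v) : 1 / 2 < t := by
  have ht := h.pos_left
  have hmirror := h.mirror.left_lt_two_thirds <| by
    rw [inv_le_comm₀ (by positivity) (by norm_num)]
    linarith
  rw [inv_lt_comm₀ (by positivity) (by norm_num)] at hmirror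
  linarith

lemma two_thirds_lt_bend (hx : 0 < x) : 2 / 3 < bend x := by
  rw [bend_eq, lt_div_iff₀ (by positivity)]
  linarith

lemma bend_lt_one (hx : 0 < x) : bend x < 1 := by
  rw [bend_eq, div_lt_one (by positivity)]
  linarith

lemma half_lt_straight (hx : 0 < x) : 1 / 2 < straight x := by
  rw [straight_eq, lt_div_iff₀ (by positivity)]
  linarith

lemma straight_lt_two_thirds (hx : 0 < x) : straight x < 2 / 3 := by
  rw [straight_eq, div_lt_iff₀ (by positivity)]
  linarith

lemma straight_mem_Icc (hx : x ∈ Set.Icc (1 / 2) (2 / 3)) :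
    straight x ∈ Set.Icc (4 / 7) (7 / 12) := by
  have hden : 0 < 3 * x + 2 := by linarith [hx.1]
  rw [straight_eq]
  exact ⟨(le_div_iff₀ hden).2 (by linarith [hx.1]), (div_le_iff₀ hden).2 (by linarith [hx.2])⟩

lemma abs_straight_sub_straight (hx : 0 < x) (hy : 0 < y) :
    |straight x - straight y| = |x - y| / ((3 * x + 2) * (3 * y + 2)) := by
  have hsub : straight x - straight y = (x - y) / ((3 * x + 2) * (3 * y + 2)) := by
    rw [straight_eq, straight_eq]
    field_simp
    ring
  rw [hsub, abs_div, abs_of_pos (by positivity : 0 < (3 * x + 2) * (3 * y + 2))]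

lemma abs_bend_sub_bend (hx : 0 < x) (hy : 0 < y) :
    |bend x - bend y| = |x - y| / ((3 * x + 1) * (3 * y + 1)) := by
  have hsub : bend x - bend y = -((x - y) / ((3 * x + 1) * (3 * y + 1))) := by
    rw [bend_eq, bend_eq]
    field_simp
    ring
  rw [hsub, abs_neg, abs_div, abs_of_pos (by positivity : 0 < (3 * x + 1) * (3 * y + 1))]

lemma abs_straight_sub_straight_le (hx : 0 < x) (hy : 0 < y) :
    |straight x - straight y| ≤ 1 / 2 * |x - y| := by
  rw [abs_straight_sub_straight hx hy, div_le_iff₀ (by positivity)]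
  nlinarith [abs_nonneg (x - y), mul_pos hx hy]

lemma abs_bend_sub_bend_le (hx : 0 < x) (hy : 0 < y) : |bend x - bend y| ≤ |x - y| := by
  rw [abs_bend_sub_bend hx hy]
  exact div_le_self (abs_nonneg _) (by nlinarith [mul_pos hx hy])

lemma eq_of_forall_exists_preimage {α : Type*} [MetricSpace α] {f : α → α} {Y : Set α} {u : α}
    {k : ℝ} (hk₀ : 0 ≤ k) (hk : k < 1) (hf : ∀ x ∈ Y, dist (f x) u ≤ k * dist x u)
    (hY : ∀ x ∈ Y, ∃ x' ∈ Y, f x' = x) (hb : Bornology.IsBounded Y) {x : α} (hx : x ∈ Y) :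
    x = u := by
  obtain ⟨C, hC⟩ := hb.subset_closedBall u
  have key (n : ℕ) : ∀ x ∈ Y, dist x u ≤ k ^ n * C := by
    induction n with
    | zero => simpa using fun x hx => hC hx
    | succ n ih =>
      intro x hx
      obtain ⟨x', hx', rfl⟩ := hY x hx
      calc dist (f x') u ≤ k * dist x' u := hf x' hx'
        _ ≤ k * (k ^ n * C) := mul_le_mul_of_nonneg_left (ih x' hx') hk₀
        _ = k ^ (n + 1) * C := by ring
  have hlim : Tendsto (fun n => k ^ n * C) atTop (𝓝 0) := by
    simpa using (tendsto_pow_atTop_nhds_zero_of_lt_one hk₀ hk).mul_const C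
  exact dist_le_zero.1 (ge_of_tendsto' hlim fun n => key n x hx)

lemma straight_inv_sqrt_three : straight (√3)⁻¹ = (√3)⁻¹ := by
  have hsq : √3 * √3 = 3 := Real.mul_self_sqrt (by norm_num)
  rw [straight_eq, div_eq_iff (by positivity)]
  field_simp
  linarith

/-- Both neighbours of a `straight` move that follows two others are again `straight`, so the
coding of such a good state is constant. -/
lemma IsGood.eq_inv_sqrt_three (h : IsGood t v) (hv : v ∈ Set.Icc (4 / 7) (7 / 12)) :
    t = (√3)⁻¹ := by
  refine eq_of_forall_exists_preimage (f := straight) (k := 1 / 2)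
    (Y := {t | ∃ v ∈ Set.Icc (4 / 7) (7 / 12), IsGood t v}) (by norm_num) (by norm_num)
    ?_ ?_ ?_ ⟨v, hv, h⟩
  · rintro x ⟨v, -, h⟩
    have hcontr := abs_straight_sub_straight_le h.pos_left (y := (√3)⁻¹) (by positivity)
    rwa [straight_inv_sqrt_three] at hcontr
  · rintro x ⟨v, hv, h⟩
    obtain ⟨x, hx, rfl⟩ := exists_straight_eq (h.half_lt_left hv.1) (h.left_lt_two_thirds hv.2)
    refine ⟨x, ⟨straight v, straight_mem_Icc ?_, h.of_straight hx⟩, rfl⟩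
    constructor <;> linarith [hv.1, hv.2]
  · exact (Metric.isBounded_Icc 0 1).subset fun x ⟨v, _, h⟩ => ⟨h.pos_left.le, h.left_lt_one.le⟩

lemma bend_iterate_pos (k : ℕ) (hx : 0 < x) : 0 < bend^[k] x := by
  induction k with
  | zero => exact hx
  | succ k ih => rw [Function.iterate_succ_apply']; exact bend_pos ih

lemma abs_bend_iterate_sub_le (k : ℕ) (hx : 0 < x) (hy : 0 < y) :
    |bend^[k] x - bend^[k] y| ≤ |x - y| := by
  induction k with
  | zero => exact le_rfl
  | succ k ih =>
    rw [Function.iterate_succ_apply', Function.iterate_succ_apply']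
    exact (abs_bend_sub_bend_le (bend_iterate_pos k hx) (bend_iterate_pos k hy)).trans ih

lemma lagrangeValue_bend_iterate (k : ℕ) (hx : 0 < x) :
    lagrangeValue (bend^[k] x) = lagrangeValue x := by
  induction k with
  | zero => rfl
  | succ k ih => rw [Function.iterate_succ_apply', lagrangeValue_bend (bend_iterate_pos k hx), ih]

/-- The positive fixed point of `bend`. -/
noncomputable def bendFix : ℝ := (1 + √13) / 6

lemma three_mul_bendFix_sq : 3 * bendFix ^ 2 = bendFix + 1 := by
  have hsq : √13 ^ 2 = 13 := Real.sq_sqrt (by norm_num)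
  unfold bendFix
  linear_combination hsq / 12

lemma bendFix_mem_Ioo : bendFix ∈ Set.Ioo 0.7675 0.7676 := by
  have hlow : (3.605 : ℝ) < √13 := Real.lt_sqrt_of_sq_lt (by norm_num)
  have hupp : √13 < 3.6056 := (Real.sqrt_lt' (by norm_num)).2 (by norm_num)
  unfold bendFix
  constructor <;> linarith

lemma bendFix_pos : 0 < bendFix := lt_trans (by norm_num) bendFix_mem_Ioo.1

lemma bend_bendFix : bend bendFix = bendFix := by
  have hpos := bendFix_pos
  rw [bend_eq, div_eq_iff (by positivity)]
  linarith [three_mul_bendFix_sq]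

lemma abs_bend_sub_bendFix_le (hx : 0 < x) : |bend x - bendFix| ≤ 1 / 2 * |x - bendFix| := by
  have hpos := bendFix_pos
  nth_rw 1 [← bend_bendFix]
  rw [abs_bend_sub_bend hx hpos, div_le_iff₀ (by positivity)]
  nlinarith [abs_nonneg (x - bendFix), mul_pos hx hpos, bendFix_mem_Ioo.1]

end GoodState

section Junction

variable {t v u : ℝ}

/-- The two good states on both sides of a `straight` move between two `bend` moves. -/
structure IsJunction (u v : ℝ) : Prop where
  left : 2 / 3 < u
  right : 2 / 3 < v
  before : IsGood (straight u) v
  after : IsGood u (straight v)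

/-- The coding of `(t, v)` is eventually straight, or meets a junction after finitely many `bend`
moves. -/
def ReachesJunction (t v : ℝ) : Prop :=
  lagrangeValue t = lagrangeValue (√3)⁻¹ ∨
    ∃ i u, t = bend^[i] (straight u) ∧ IsJunction u (bend^[i] v)

lemma ReachesJunction.bend (ht : 0 < t) (h : ReachesJunction t (bend v)) :
    ReachesJunction (bend t) v := by
  rcases h with h | ⟨i, u, rfl, h⟩
  · exact Or.inl (by rw [lagrangeValue_bend ht, h])
  · exact Or.inr ⟨i + 1, u, by rw [Function.iterate_succ_apply'],
      by rwa [Function.iterate_succ_apply]⟩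

lemma IsGood.reachesJunction_straight (h : IsGood (straight u) v) (hu : 0 < u) (hv : 2 / 3 < v) :
    ReachesJunction (straight u) v := by
  have hv₀ := h.pos_right
  have hafter : IsGood u (straight v) := h.of_straight hu
  rcases hafter.ne_two_thirds.lt_or_gt with hlt | hgt
  · have hstraight : 7 / 12 ≤ straight v := by
      rw [straight_eq, le_div_iff₀ (by positivity)]
      linarith
    obtain ⟨w, hw, rfl⟩ := exists_straight_eq (hafter.half_lt_left (by linarith)) hlt
    have hgood : IsGood w (straight (straight v)) := hafter.of_straight hw
    refine Or.inl ?_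
    rw [lagrangeValue_straight hu, lagrangeValue_straight hw, hgood.eq_inv_sqrt_three
      (straight_mem_Icc ⟨(half_lt_straight hv₀).le, (straight_lt_two_thirds hv₀).le⟩)]
  · exact Or.inr ⟨0, u, rfl, hgt, hv, h, hafter⟩

lemma IsGood.eq_bendFix_or_reachesJunction (h : IsGood t v) (hv : 2 / 3 < v) :
    t = bendFix ∨ ReachesJunction t v := by
  refine or_iff_not_imp_right.2 fun hreach => ?_
  refine eq_of_forall_exists_preimage (f := bend) (k := 1 / 2)
    (Y := {t | ∃ v, 2 / 3 < v ∧ IsGood t v ∧ ¬ReachesJunction t v}) (by norm_num) (by norm_num)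
    ?_ ?_ ?_ ⟨v, hv, h, hreach⟩
  · rintro x ⟨v, -, h, -⟩
    exact abs_bend_sub_bendFix_le h.pos_left
  · rintro x ⟨v, hv, h, hreach⟩
    rcases h.ne_two_thirds.lt_or_gt with hlt | hgt
    · obtain ⟨u, hu, rfl⟩ := exists_straight_eq (h.half_lt_left (by linarith)) hlt
      exact absurd (h.reachesJunction_straight hu hv) hreach
    · obtain ⟨x, hx, rfl⟩ := exists_bend_eq hgt h.left_lt_one
      exact ⟨x, ⟨bend v, two_thirds_lt_bend h.pos_right, h.of_bend hx,
        fun hx' => hreach (hx'.bend hx)⟩, rfl⟩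
  · exact (Metric.isBounded_Icc 0 1).subset fun x ⟨v, _, h, _⟩ =>
      ⟨h.pos_left.le, h.left_lt_one.le⟩

lemma IsJunction.left_lt_one (h : IsJunction u v) : u < 1 := h.after.left_lt_one

lemma IsJunction.right_lt_one (h : IsJunction u v) : v < 1 := h.before.right_lt_one

lemma IsJunction.exists_next (h : IsJunction u v) :
    lagrangeValue u = lagrangeValue bendFix ∨ lagrangeValue u = lagrangeValue (√3)⁻¹ ∨
      ∃ k u', 1 ≤ k ∧ u = bend^[k] (straight u') ∧ IsJunction u' (bend^[k] (straight v)) := by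
  obtain ⟨x, hx, rfl⟩ := exists_bend_eq h.left h.left_lt_one
  have hgood : IsGood x (bend (straight v)) := h.after.of_bend hx
  rw [lagrangeValue_bend hx]
  rcases hgood.eq_bendFix_or_reachesJunction (two_thirds_lt_bend h.after.pos_right) with
    hfix | hfix | ⟨i, u, rfl, hjunction⟩
  · exact Or.inl (by rw [hfix])
  · exact Or.inr (Or.inl hfix)
  · exact Or.inr (Or.inr ⟨i + 1, u, by omega, by rw [Function.iterate_succ_apply'],
      by rwa [Function.iterate_succ_apply]⟩)

end Junction

section Multiplier

variable {u v x y r μ : ℝ} {i j k m : ℕ}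

/-- The negative fixed point of `bend`. -/
noncomputable def bendConj : ℝ := 1 / 3 - bendFix

lemma bendConj_neg : bendConj < 0 := by
  unfold bendConj
  linarith [bendFix_mem_Ioo.1]

/-- The projective coordinate with zero `bendFix` and pole `bendConj`, in which `bend` is linear. -/
noncomputable def bendCoord (x : ℝ) : ℝ := (bendFix - x) / (x - bendConj)

/-- The multiplier of `bend` at its fixed points. -/
noncomputable def bendMult : ℝ := (3 * bendConj + 1) / (3 * bendFix + 1)

/-- The multiplier of the map `v ↦ (5 v + 2) / (6 v + 3)`, which has the fixed points of `bend` and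
gives the extreme left end of a junction with right end `v`. -/
noncomputable def junctionMult : ℝ := (6 * bendConj + 3) / (6 * bendFix + 3)

lemma bendMult_mem_Ioo : bendMult ∈ Set.Ioo (-0.0919) (-0.0915) := by
  obtain ⟨hlow, hupp⟩ := bendFix_mem_Ioo
  have hden : 0 < 3 * bendFix + 1 := by linarith
  unfold bendMult bendConj
  exact ⟨(lt_div_iff₀ hden).2 (by linarith), (div_lt_iff₀ hden).2 (by linarith)⟩

lemma junctionMult_mem_Ioo : junctionMult ∈ Set.Ioo 0.05 0.06 := by
  obtain ⟨hlow, hupp⟩ := bendFix_mem_Ioo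
  have hden : 0 < 6 * bendFix + 3 := by linarith
  unfold junctionMult bendConj
  exact ⟨(lt_div_iff₀ hden).2 (by linarith), (div_lt_iff₀ hden).2 (by linarith)⟩

lemma bendCoord_bend (hx : 0 < x) : bendCoord (bend x) = bendMult * bendCoord x := by
  have hconj := bendConj_neg
  have hfix := bendFix_pos
  have hpole : 0 < x - bendConj := by linarith
  have hpole' : 0 < bend x - bendConj := by linarith [bend_pos hx]
  have hden : 0 < 3 * bendFix + 1 := by positivity
  unfold bendCoord bendMult
  rw [div_mul_div_comm, div_eq_div_iff hpole'.ne' (mul_pos hden hpole).ne', bend_eq]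
  unfold bendConj
  field_simp
  linear_combination (6 * bendFix - 1) * (3 * x + 1) * three_mul_bendFix_sq

lemma bendCoord_bend_iterate (k : ℕ) (hx : 0 < x) :
    bendCoord (bend^[k] x) = bendMult ^ k * bendCoord x := by
  induction k with
  | zero => simp
  | succ k ih =>
    rw [Function.iterate_succ_apply', bendCoord_bend (bend_iterate_pos k hx), ih, pow_succ']
    ring

lemma junctionMult_mul_bendCoord_le (hu : 0 < u) (hv : 0 < v)
    (h : (6 * v + 3) * u ≤ 5 * v + 2) : junctionMult * bendCoord v ≤ bendCoord u := by
  have hconj := bendConj_neg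
  have hfix := bendFix_pos
  have hpole_u : 0 < u - bendConj := by linarith
  have hpole_v : 0 < v - bendConj := by linarith
  have hden : 0 < 6 * bendFix + 3 := by positivity
  unfold bendCoord junctionMult
  rw [div_mul_div_comm, div_le_div_iff₀ (mul_pos hden hpole_v) hpole_u, ← sub_nonneg]
  calc 0 ≤ (bendFix - bendConj) * (5 * v + 2 - (6 * v + 3) * u) :=
        mul_nonneg (by linarith) (by linarith)
    _ = _ := by
        unfold bendConj
        linear_combination (2 / 3 - 4 * bendFix) * three_mul_bendFix_sq

lemma mul_le_of_quarter_le_straight (hv : 0 < v)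
    (h : 1 / 4 * (3 * u * straight v + 1) ≤ straight v) : (6 * v + 3) * u ≤ 5 * v + 2 := by
  have hmul : straight v * (3 * v + 2) = 2 * v + 1 := by
    rw [straight_eq, div_mul_cancel₀ _ (by positivity)]
  have hscale := mul_le_mul_of_nonneg_right h (by positivity : 0 ≤ 3 * v + 2)
  linear_combination 4 * hscale + (4 - 3 * u) * hmul

lemma IsJunction.mul_bendCoord_right_le (h : IsJunction u v) :
    junctionMult * bendCoord v ≤ bendCoord u :=
  have hv := h.before.pos_right
  junctionMult_mul_bendCoord_le h.after.pos_left hv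
    (mul_le_of_quarter_le_straight hv h.after.mul_le_right)

lemma IsJunction.mul_bendCoord_left_le (h : IsJunction u v) :
    junctionMult * bendCoord u ≤ bendCoord v :=
  have hu := h.after.pos_left
  junctionMult_mul_bendCoord_le h.before.pos_right hu <|
    mul_le_of_quarter_le_straight hu <| by simpa only [mul_right_comm] using h.before.mul_le_left

lemma straight_mem_Icc_of_mem_Ioo (hx : x ∈ Set.Ioo (2 / 3) 1) :
    straight x ∈ Set.Icc (7 / 12) (3 / 5) := by
  have hden : 0 < 3 * x + 2 := by linarith [hx.1]
  rw [straight_eq]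
  exact ⟨(le_div_iff₀ hden).2 (by linarith [hx.1]), (div_le_iff₀ hden).2 (by linarith [hx.2])⟩

lemma bendCoord_straight_mem_Icc (hx : x ∈ Set.Ioo (2 / 3) 1) :
    bendCoord (straight x) ∈ Set.Icc 0.16 0.182 := by
  obtain ⟨hlow, hupp⟩ := straight_mem_Icc_of_mem_Ioo hx
  obtain ⟨hfix_low, hfix_upp⟩ := bendFix_mem_Ioo
  have hpole : 0 < straight x - bendConj := by linarith [bendConj_neg]
  unfold bendCoord
  refine ⟨(le_div_iff₀ hpole).2 ?_, (div_le_iff₀ hpole).2 ?_⟩ <;> unfold bendConj <;> linarith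

lemma even_of_mul_pow_le (hr : r < 0) (hμ : μ ∈ Set.Ioo 0 1) (hx : 0 < x)
    (h₁ : μ * (r ^ m * y) ≤ r ^ k * x) (h₂ : μ * (r ^ k * x) ≤ r ^ m * y) : Even k := by
  have hnonneg : 0 ≤ r ^ k * x := by
    have hle : μ * μ * (r ^ k * x) ≤ r ^ k * x := by
      rw [mul_assoc]
      exact (mul_le_mul_of_nonneg_left h₂ hμ.1.le).trans h₁
    nlinarith [mul_lt_one_of_nonneg_of_lt_one_left hμ.1.le hμ.2 hμ.2.le]
  by_contra hodd
  exact hnonneg.not_gt (mul_neg_of_neg_of_pos ((Nat.not_even_iff_odd.1 hodd).pow_neg hr) hx)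

lemma le_of_mul_pow_le (hr₀ : 0 < r) (hr₁ : r ≤ 1) (hy : 0 ≤ y) (hlt : r * y < μ * x)
    (h : μ * (r ^ i * x) ≤ r ^ j * y) : j ≤ i := by
  by_contra! hij
  refine h.not_gt ?_
  calc r ^ j * y ≤ r ^ (i + 1) * y :=
        mul_le_mul_of_nonneg_right (pow_le_pow_of_le_one hr₀.le hr₁ hij) hy
    _ = r ^ i * (r * y) := by ring
    _ < r ^ i * (μ * x) := mul_lt_mul_of_pos_left hlt (pow_pos hr₀ i)
    _ = μ * (r ^ i * x) := by ring

/-- Around a junction the two blocks of `bend` moves have the same even length: the junction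
inequality is violated by the sign of `bendMult ^ k` if `k` is odd, and by its size if the lengths
differ. -/
lemma IsJunction.even_and_eq (h : IsJunction (bend^[k] (straight u)) (bend^[m] (straight v)))
    (hu : u ∈ Set.Ioo (2 / 3) 1) (hv : v ∈ Set.Ioo (2 / 3) 1) : Even k ∧ k = m := by
  obtain ⟨hx₁, hx₂⟩ := bendCoord_straight_mem_Icc hu
  obtain ⟨hy₁, hy₂⟩ := bendCoord_straight_mem_Icc hv
  obtain ⟨hr₁, hr₂⟩ := bendMult_mem_Ioo
  obtain ⟨hμ₁, hμ₂⟩ := junctionMult_mem_Ioo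
  have hle := h.mul_bendCoord_right_le
  have hle' := h.mul_bendCoord_left_le
  have hu₀ : 0 < u := lt_trans (by norm_num) hu.1
  have hv₀ : 0 < v := lt_trans (by norm_num) hv.1
  rw [bendCoord_bend_iterate _ (straight_pos hu₀),
    bendCoord_bend_iterate _ (straight_pos hv₀)] at hle hle'
  have hμ : junctionMult ∈ Set.Ioo 0 1 := ⟨by linarith, by linarith⟩
  have hk : Even k := even_of_mul_pow_le (by linarith) hμ (by linarith) hle hle'
  have hm : Even m := even_of_mul_pow_le (by linarith) hμ (by linarith) hle' hle
  refine ⟨hk, ?_⟩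
  obtain ⟨i, rfl⟩ := hk.two_dvd
  obtain ⟨j, rfl⟩ := hm.two_dvd
  rw [pow_mul, pow_mul] at hle hle'
  have hsq₀ : 0 < bendMult ^ 2 := by nlinarith
  have hsq : bendMult ^ 2 < 0.0085 := by nlinarith
  have hij : i ≤ j := le_of_mul_pow_le hsq₀ (by linarith) (by linarith) (by nlinarith) hle
  have hji : j ≤ i := le_of_mul_pow_le hsq₀ (by linarith) (by linarith) (by nlinarith) hle'
  omega

end Multiplier

section Classification

variable {k : ℕ} {t v u w x : ℝ}

/-- `w` has the periodic coding with period one `straight` move followed by `k` `bend` moves. -/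
structure IsCycle (k : ℕ) (w : ℝ) : Prop where
  pos : 0 < w
  eq : bend^[k] (straight w) = w

lemma bend_iterate_straight_lt_one (k : ℕ) (hx : 0 ≤ x) : bend^[k] (straight x) < 1 := by
  have hs : 0 < straight x := by rw [straight_eq]; positivity
  cases k with
  | zero =>
    rw [Function.iterate_zero_apply, straight_eq, div_lt_one (by positivity)]
    linarith
  | succ k =>
    rw [Function.iterate_succ_apply']
    exact bend_lt_one (bend_iterate_pos k hs)

lemma continuousOn_bend_iterate_straight (k : ℕ) :
    ContinuousOn (fun x => bend^[k] (straight x)) (Set.Ici 0) := by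
  induction k with
  | zero =>
    simp only [Function.iterate_zero_apply, straight_eq]
    exact ContinuousOn.div (by fun_prop) (by fun_prop) fun x (hx : 0 ≤ x) => by positivity
  | succ k ih =>
    simp only [Function.iterate_succ_apply']
    have hbend : ContinuousOn bend (Set.Ioi 0) := by
      rw [funext bend_eq]
      exact ContinuousOn.div (by fun_prop) (by fun_prop) fun x (hx : 0 < x) => by positivity
    refine hbend.comp ih fun x (hx : 0 ≤ x) => bend_iterate_pos k ?_
    rw [straight_eq]
    positivity

lemma exists_isCycle (k : ℕ) : ∃ w, IsCycle k w := by
  have hzero : 0 < bend^[k] (straight 0) := bend_iterate_pos k (by norm_num [straight_eq])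
  have hone := bend_iterate_straight_lt_one k zero_le_one
  obtain ⟨w, hw, hfix⟩ := intermediate_value_Icc' zero_le_one
    (((continuousOn_bend_iterate_straight k).mono Set.Icc_subset_Ici_self).sub continuousOn_id)
    (show (0 : ℝ) ∈ Set.Icc _ _ from ⟨(sub_neg.2 hone).le, by simpa using hzero.le⟩)
  replace hfix : bend^[k] (straight w) = w := sub_eq_zero.1 hfix
  refine ⟨w, hw.1.lt_of_ne ?_, hfix⟩
  rintro rfl
  exact hzero.ne' hfix

lemma IsCycle.abs_bend_iterate_straight_sub_le (h : IsCycle k w) (hx : 0 < x) :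
    |bend^[k] (straight x) - w| ≤ 1 / 2 * |x - w| :=
  calc |bend^[k] (straight x) - w| = |bend^[k] (straight x) - bend^[k] (straight w)| := by
        rw [h.eq]
    _ ≤ |straight x - straight w| :=
        abs_bend_iterate_sub_le k (straight_pos hx) (straight_pos h.pos)
    _ ≤ 1 / 2 * |x - w| := abs_straight_sub_straight_le hx h.pos

/-- The value `y` comes from a constant coding, or from a periodic coding with blocks of `bend`
moves of equal even length. -/
def IsClassified (y : ENNReal) : Prop :=
  y = lagrangeValue bendFix ∨ y = lagrangeValue (√3)⁻¹ ∨
    ∃ k w, 1 ≤ k ∧ Even k ∧ IsCycle k w ∧ y = lagrangeValue w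

/-- A junction whose past begins with a block of exactly `k` `bend` moves. -/
structure IsJunctionAfter (k : ℕ) (u v : ℝ) : Prop extends IsJunction u v where
  past : ∃ v₀ ∈ Set.Ioo (2 / 3) 1, v = bend^[k] (straight v₀)

lemma IsJunctionAfter.isClassified_or_exists (h : IsJunctionAfter k u v) :
    IsClassified (lagrangeValue u) ∨
      Even k ∧ ∃ u' v', u = bend^[k] (straight u') ∧ IsJunctionAfter k u' v' := by
  obtain ⟨hjunction, v₀, hv₀, rfl⟩ := h
  rcases hjunction.exists_next with hfix | hfix | ⟨m, u', -, rfl, hnext⟩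
  · exact Or.inl (Or.inl hfix)
  · exact Or.inl (Or.inr (Or.inl hfix))
  · obtain ⟨heven, rfl⟩ := hjunction.even_and_eq ⟨hnext.left, hnext.left_lt_one⟩ hv₀
    exact Or.inr ⟨heven, u', _, rfl, hnext, _, ⟨hjunction.right, hjunction.right_lt_one⟩, rfl⟩

lemma IsJunctionAfter.isClassified (h : IsJunctionAfter k u v) (hk : 1 ≤ k) :
    IsClassified (lagrangeValue u) := by
  by_contra hu
  obtain ⟨w, hw⟩ := exists_isCycle k
  have hstep {x y : ℝ} (h : IsJunctionAfter k x y) (hx : lagrangeValue x = lagrangeValue u) :=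
    h.isClassified_or_exists.resolve_left (hx ▸ hu)
  suffices u = w from hu (Or.inr (Or.inr ⟨k, w, hk, (hstep h rfl).1, hw, by rw [this]⟩))
  refine eq_of_forall_exists_preimage (f := fun x => bend^[k] (straight x)) (k := 1 / 2)
    (Y := {x | ∃ y, IsJunctionAfter k x y ∧ lagrangeValue x = lagrangeValue u})
    (by norm_num) (by norm_num) ?_ ?_ ?_ ⟨v, h, rfl⟩
  · rintro x ⟨y, h, -⟩
    exact hw.abs_bend_iterate_straight_sub_le h.after.pos_left
  · rintro x ⟨y, h, hx⟩
    obtain ⟨-, x', y', rfl, h'⟩ := hstep h hx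
    have hx' := h'.after.pos_left
    rw [lagrangeValue_bend_iterate k (straight_pos hx'), lagrangeValue_straight hx'] at hx
    exact ⟨x', ⟨y', h', hx⟩, rfl⟩
  · exact (Metric.isBounded_Icc 0 1).subset fun x ⟨y, h, _⟩ =>
      ⟨h.after.pos_left.le, h.left_lt_one.le⟩

lemma IsJunction.isClassified (h : IsJunction u v) : IsClassified (lagrangeValue u) := by
  rcases h.exists_next with hfix | hfix | ⟨k, u', hk, rfl, hnext⟩
  · exact Or.inl hfix
  · exact Or.inr (Or.inl hfix)
  · have hu' := hnext.after.pos_left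
    rw [lagrangeValue_bend_iterate k (straight_pos hu'), lagrangeValue_straight hu']
    exact IsJunctionAfter.isClassified ⟨hnext, v, ⟨h.right, h.right_lt_one⟩, rfl⟩ hk

lemma IsGood.isClassified_of_two_thirds_lt_right (h : IsGood t v) (hv : 2 / 3 < v) :
    IsClassified (lagrangeValue t) := by
  rcases h.eq_bendFix_or_reachesJunction hv with hfix | hfix | ⟨i, u, rfl, hjunction⟩
  · exact Or.inl (by rw [hfix])
  · exact Or.inr (Or.inl hfix)
  · have hu := hjunction.after.pos_left
    rw [lagrangeValue_bend_iterate i (straight_pos hu), lagrangeValue_straight hu]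
    exact hjunction.isClassified

lemma IsGood.isClassified_of_two_thirds_lt_left (h : IsGood t v) (ht : 2 / 3 < t) :
    IsClassified (lagrangeValue t) := by
  obtain ⟨x, hx, rfl⟩ := exists_bend_eq ht h.left_lt_one
  have hgood : IsGood x (bend v) := h.of_bend hx
  rw [lagrangeValue_bend hx]
  exact hgood.isClassified_of_two_thirds_lt_right (two_thirds_lt_bend h.pos_right)

lemma IsGood.isClassified_of_four_sevenths_le_right (h : IsGood t v) (hv : 4 / 7 ≤ v)
    (hv' : v < 2 / 3) : IsClassified (lagrangeValue t) := by
  rcases h.ne_two_thirds.lt_or_gt with hlt | hgt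
  · obtain ⟨x, hx, rfl⟩ := exists_straight_eq (h.half_lt_left hv) hlt
    have hgood : IsGood x (straight v) := h.of_straight hx
    refine Or.inr (Or.inl ?_)
    rw [lagrangeValue_straight hx,
      hgood.eq_inv_sqrt_three (straight_mem_Icc ⟨by linarith, hv'.le⟩)]
  · exact h.isClassified_of_two_thirds_lt_left hgt

lemma IsGood.isClassified_of_half_lt_right (h : IsGood t v) (hv : 1 / 2 < v) (hv' : v < 2 / 3) :
    IsClassified (lagrangeValue t) := by
  rcases le_or_gt (4 / 7) v with hge | hlt
  · exact h.isClassified_of_four_sevenths_le_right hge hv'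
  · have hv₀ := h.pos_right
    rw [← lagrangeValue_mirror h.pos_left]
    refine h.mirror.isClassified_of_four_sevenths_le_right ?_ ?_
    · rw [le_inv_comm₀ (by norm_num) (mul_pos three_pos hv₀)]
      linarith
    · rw [inv_lt_comm₀ (mul_pos three_pos hv₀) (by norm_num)]
      linarith

lemma IsGood.isClassified (h : IsGood t v) : IsClassified (lagrangeValue t) := by
  rcases h.ne_half.lt_or_gt with hlt | hgt
  · have ht := h.pos_left
    rw [← lagrangeValue_mirror ht]
    refine h.mirror.isClassified_of_two_thirds_lt_left ?_
    rw [lt_inv_comm₀ (by norm_num) (by positivity)]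
    linarith
  · rcases h.ne_two_thirds.lt_or_gt with hlt' | hgt'
    · obtain ⟨x, hx, rfl⟩ := exists_straight_eq hgt hlt'
      have hgood : IsGood x (straight v) := h.of_straight hx
      rw [lagrangeValue_straight hx]
      exact hgood.isClassified_of_half_lt_right (half_lt_straight h.pos_right)
        (straight_lt_two_thirds h.pos_right)
    · exact h.isClassified_of_two_thirds_lt_left hgt'

lemma isClassified_lagrangeValue (ht : 0 < t) (h : ENNReal.ofReal (√3 / 4) < lagrangeValue t) :
    IsClassified (lagrangeValue t) := by
  obtain ⟨t', v, heq, hgood⟩ :=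
    hasState_zero_of_lt (κ := 1 / 4) ht (by norm_num) (by rwa [mul_one_div])
  rw [← heq]
  exact IsGood.isClassified hgood

end Classification

section EdgeBound

variable {a b c d p q : ℕ} {t v x κ τ ν e : ℝ} {S T : Set (ℕ × ℕ)}

lemma FormBoundOn.of_cone (h : FormBoundOn κ S t (move a c b d v))
    (hdet : |(a * d - 3 * b * c : ℝ)| = 1) (ha : 0 < a) (hd : 0 < d) (hv : 0 < v)
    (hleft : ∀ p q, (p, q) ∈ T → κ ≤ formValue (move a b c d t) (3 * v) p q ∨
      ∃ p' q', (p', q') ∈ S ∧ a * p' + b * q' = p ∧ 3 * c * p' + d * q' = q)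
    (hright : ∀ p q, (p, q) ∈ T → κ ≤ formValue (3 * move a b c d t) v p q ∨
      ∃ p' q', (p', q') ∈ S ∧ a * p' + 3 * b * q' = p ∧ c * p' + d * q' = q) :
    FormBoundOn κ T (move a b c d t) v where
  pos_left := move_pos ha hd h.pos_left
  pos_right := hv
  le_left p q hpq := by
    rcases hleft p q hpq with hle | ⟨p', q', hS, rfl, rfl⟩
    · exact hle
    · exact (h.le_left p' q' hS).trans_eq (formValue_move_left hdet hd h.pos_left hv p' q').symm
  le_right p q hpq := by
    rcases hright p q hpq with hle | ⟨p', q', hS, rfl, rfl⟩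
    · exact hle
    · exact (h.le_right p' q' hS).trans_eq (formValue_move_right hdet hd h.pos_left hv p' q').symm

lemma le_formValue (hτ : 0 < τ) (hν : 0 < ν) (he : e ≤ |(p : ℝ) - τ * q|)
    (h : κ * (τ * ν + 1) ≤ e * (ν * p + q)) : κ ≤ formValue τ ν p q := by
  rw [formValue, le_div_iff₀ (by positivity)]
  exact h.trans (mul_le_mul_of_nonneg_right he (by positivity))

/-- The forms of the state `(t, v)` are at least `κ` at the vertices `(0, 1)` and `(1, 0)` of the
quadrant, and `t` and `v` lie in the range of the coding. -/
structure IsEdgeBound (κ t v : ℝ) : Prop where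
  pos_left : 0 < t
  left_lt_one : t < 1
  pos_right : 0 < v
  right_le_one : v ≤ 1
  le_left : κ * (3 * t * v + 1) ≤ t
  le_right : κ * (3 * t * v + 1) ≤ v

namespace IsEdgeBound

lemma le_mul_add (h : IsEdgeBound κ t v) (hpq : 0 < p + q) : κ * (3 * t * v + 1) ≤ v * p + q := by
  have hv := h.pos_right
  rcases Nat.eq_zero_or_pos p with rfl | hp
  · have hq : (1 : ℝ) ≤ q := by exact_mod_cast (by omega : 1 ≤ q)
    simpa using h.le_left.trans (h.left_lt_one.le.trans hq)
  · have hp : (1 : ℝ) ≤ p := by exact_mod_cast hp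
    calc κ * (3 * t * v + 1) ≤ v * 1 := by simpa using h.le_right
      _ ≤ v * p := mul_le_mul_of_nonneg_left hp hv.le
      _ ≤ v * p + q := le_add_of_nonneg_right q.cast_nonneg

lemma le_right_of_one_le (h : IsEdgeBound κ t v) (hpq : 0 < p + q)
    (he : 1 ≤ |(p : ℝ) - 3 * t * q|) : κ ≤ formValue (3 * t) v p q :=
  le_formValue (mul_pos three_pos h.pos_left) h.pos_right he <| by
    simpa using h.le_mul_add hpq

lemma le_left_of_one_le (h : IsEdgeBound κ t v) (hpq : 0 < p + q) (he : 1 ≤ |(p : ℝ) - t * q|) :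
    κ ≤ formValue t (3 * v) p q := by
  have hv := h.pos_right
  refine le_formValue h.pos_left (by positivity) he ?_
  have hle := h.le_mul_add hpq
  have : 0 ≤ v * p := by positivity
  linarith

lemma le_left_zero (h : IsEdgeBound κ t v) (hq : 0 < q) : κ ≤ formValue t (3 * v) 0 q := by
  have ht := h.pos_left
  have hv := h.pos_right
  have hq : (1 : ℝ) ≤ q := by exact_mod_cast hq
  refine le_formValue (e := t) ht (by positivity) ?_ ?_
  · rw [Nat.cast_zero, zero_sub, abs_neg, abs_of_nonneg (by positivity)]
    exact le_mul_of_one_le_right ht.le hq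
  · have := le_mul_of_one_le_right ht.le hq
    rw [Nat.cast_zero, mul_zero, zero_add]
    linarith [h.le_left]

lemma le_left_of_third_le (h : IsEdgeBound κ t v) (hκ : κ ≤ 1 / 3) (hp : 0 < p) (hq : 0 < q)
    (he : 1 / 3 ≤ |(p : ℝ) - t * q|) : κ ≤ formValue t (3 * v) p q := by
  have ht := h.pos_left
  have hv := h.pos_right
  have hp : (1 : ℝ) ≤ p := by exact_mod_cast hp
  have hq : (1 : ℝ) ≤ q := by exact_mod_cast hq
  refine le_formValue ht (by positivity) he ?_
  calc κ * (t * (3 * v) + 1) ≤ 1 / 3 * (1 * (3 * v) + 1) :=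
        mul_le_mul hκ (by gcongr; exact h.left_lt_one.le) (by positivity) (by norm_num)
    _ ≤ 1 / 3 * (3 * v * p + q) := by nlinarith

lemma le_right_of_half_le (h : IsEdgeBound κ t v) (hκ : κ ≤ 1 / 3) (ht : t < 2 / 3) (hp : 0 < p)
    (hq : 0 < q) (he : 1 / 2 ≤ |(p : ℝ) - 3 * t * q|) : κ ≤ formValue (3 * t) v p q := by
  have ht₀ := h.pos_left
  have hv := h.pos_right
  have hp : (1 : ℝ) ≤ p := by exact_mod_cast hp
  have hq : (1 : ℝ) ≤ q := by exact_mod_cast hq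
  refine le_formValue (by positivity) hv he ?_
  calc κ * (3 * t * v + 1) ≤ 1 / 3 * (3 * (2 / 3) * v + 1) :=
        mul_le_mul hκ (by gcongr) (by positivity) (by norm_num)
    _ ≤ 1 / 2 * (v * 1 + 1) := by linarith [h.right_le_one]
    _ ≤ 1 / 2 * (v * p + q) := by gcongr

lemma le_left_of_two_thirds_lt (h : IsEdgeBound κ t v) (hκ : κ ≤ 1 / 3) (ht : 2 / 3 < t)
    (hpq : q < p ∨ 3 * p < 2 * q) : κ ≤ formValue t (3 * v) p q := by
  have hq₀ : (0 : ℝ) ≤ q := q.cast_nonneg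
  have ht₁ := mul_le_mul_of_nonneg_right h.left_lt_one.le hq₀
  have ht₂ := mul_le_mul_of_nonneg_right ht.le hq₀
  rcases hpq with hlt | hlt
  · have hcast : (q : ℝ) + 1 ≤ p := by exact_mod_cast hlt
    exact h.le_left_of_one_le (by omega) (le_abs.2 (Or.inl (by linarith)))
  · have hcast : 3 * (p : ℝ) + 1 ≤ 2 * q := by exact_mod_cast hlt
    rcases Nat.eq_zero_or_pos p with rfl | hp
    · exact h.le_left_zero (by omega)
    · exact h.le_left_of_third_le hκ hp (by omega) (le_abs.2 (Or.inr (by linarith)))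

lemma le_right_of_two_thirds_lt (h : IsEdgeBound κ t v) (ht : 2 / 3 < t)
    (hpq : 3 * q < p ∨ p < 2 * q) : κ ≤ formValue (3 * t) v p q := by
  have hq₀ : (0 : ℝ) ≤ q := q.cast_nonneg
  have ht₁ := mul_le_mul_of_nonneg_right h.left_lt_one.le hq₀
  have ht₂ := mul_le_mul_of_nonneg_right ht.le hq₀
  refine h.le_right_of_one_le (by omega) (le_abs.2 ?_)
  rcases hpq with hlt | hlt
  · have hcast : 3 * (q : ℝ) + 1 ≤ p := by exact_mod_cast hlt
    exact Or.inl (by linarith)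
  · have hcast : (p : ℝ) + 1 ≤ 2 * q := by exact_mod_cast hlt
    exact Or.inr (by linarith)

lemma le_left_of_mem_Ioo (h : IsEdgeBound κ t v) (hκ : κ ≤ 1 / 3) (ht : t ∈ Set.Ioo (1 / 2) (2 / 3))
    (hpq : 2 * q < 3 * p ∨ 2 * p < q) : κ ≤ formValue t (3 * v) p q := by
  have hq₀ : (0 : ℝ) ≤ q := q.cast_nonneg
  have ht₁ := mul_le_mul_of_nonneg_right ht.1.le hq₀
  have ht₂ := mul_le_mul_of_nonneg_right ht.2.le hq₀
  rcases hpq with hlt | hlt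
  · have hcast : 2 * (q : ℝ) + 1 ≤ 3 * p := by exact_mod_cast hlt
    rcases Nat.eq_zero_or_pos q with rfl | hq
    · have hp : (1 : ℝ) ≤ p := by exact_mod_cast (by omega : 1 ≤ p)
      exact h.le_left_of_one_le (by omega) (le_abs.2 (Or.inl (by simpa using hp)))
    · exact h.le_left_of_third_le hκ (by omega) hq (le_abs.2 (Or.inl (by linarith)))
  · have hcast : 2 * (p : ℝ) + 1 ≤ q := by exact_mod_cast hlt
    rcases Nat.eq_zero_or_pos p with rfl | hp
    · exact h.le_left_zero (by omega)
    · exact h.le_left_of_third_le hκ hp (by omega) (le_abs.2 (Or.inr (by linarith)))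

lemma le_right_of_mem_Ioo (h : IsEdgeBound κ t v) (hκ : κ ≤ 1 / 3)
    (ht : t ∈ Set.Ioo (1 / 2) (2 / 3)) (hpq : 2 * q < p ∨ 2 * p < 3 * q) :
    κ ≤ formValue (3 * t) v p q := by
  have hq₀ : (0 : ℝ) ≤ q := q.cast_nonneg
  have ht₁ := mul_le_mul_of_nonneg_right ht.1.le hq₀
  have ht₂ := mul_le_mul_of_nonneg_right ht.2.le hq₀
  rcases hpq with hlt | hlt
  · have hcast : 2 * (q : ℝ) + 1 ≤ p := by exact_mod_cast hlt
    exact h.le_right_of_one_le (by omega) (le_abs.2 (Or.inl (by linarith)))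
  · have hcast : 2 * (p : ℝ) + 1 ≤ 3 * q := by exact_mod_cast hlt
    rcases Nat.eq_zero_or_pos p with rfl | hp
    · have hq : (1 : ℝ) ≤ q := by exact_mod_cast (by omega : 1 ≤ q)
      exact h.le_right_of_one_le (by omega) (le_abs.2 (Or.inr (by push_cast; linarith)))
    · exact h.le_right_of_half_le hκ ht.2 hp (by omega) (le_abs.2 (Or.inr (by linarith)))

/-- The nonzero points of the quadrant with coordinate sum at most `n`. -/
def triangle (n : ℕ) : Set (ℕ × ℕ) := {x | 0 < x.1 + x.2 ∧ x.1 + x.2 ≤ n}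

lemma formBoundOn_bend {n : ℕ} (h : IsEdgeBound κ (bend x) v) (hκ : κ ≤ 1 / 3) (hx : 0 < x)
    (hnext : FormBoundOn κ (triangle n) x (bend v)) :
    FormBoundOn κ (triangle (n + 1)) (bend x) v := by
  have hbend := two_thirds_lt_bend hx
  refine FormBoundOn.of_cone hnext (by norm_num) two_pos one_pos h.pos_right
    (fun p q hpq => or_iff_not_imp_left.2 fun hout => ?_)
    (fun p q hpq => or_iff_not_imp_left.2 fun hout => ?_) <;>
    simp only [triangle, Set.mem_ofPred_eq] at hpq ⊢
  · have hcone := mt (h.le_left_of_two_thirds_lt hκ hbend) hout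
    exact ⟨q - p, 3 * p - 2 * q, by omega, by omega, by omega⟩
  · have hcone := mt (h.le_right_of_two_thirds_lt hbend) hout
    exact ⟨3 * q - p, p - 2 * q, by omega, by omega, by omega⟩

lemma formBoundOn_straight {n : ℕ} (h : IsEdgeBound κ (straight x) v) (hκ : κ ≤ 1 / 3)
    (hx : 0 < x) (hnext : FormBoundOn κ (triangle n) x (straight v)) :
    FormBoundOn κ (triangle (n + 1)) (straight x) v := by
  have hstraight : straight x ∈ Set.Ioo (1 / 2) (2 / 3) :=
    ⟨half_lt_straight hx, straight_lt_two_thirds hx⟩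
  refine FormBoundOn.of_cone hnext (by norm_num) two_pos two_pos h.pos_right
    (fun p q hpq => or_iff_not_imp_left.2 fun hout => ?_)
    (fun p q hpq => or_iff_not_imp_left.2 fun hout => ?_) <;>
    simp only [triangle, Set.mem_ofPred_eq] at hpq ⊢
  · have hcone := mt (h.le_left_of_mem_Ioo hκ hstraight) hout
    exact ⟨2 * p - q, 2 * q - 3 * p, by omega, by omega, by omega⟩
  · have hcone := mt (h.le_right_of_mem_Ioo hκ hstraight) hout
    exact ⟨2 * p - 3 * q, 2 * q - p, by omega, by omega, by omega⟩

end IsEdgeBound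

/-- The cones of the moves exhaust the quadrant up to points where the edge bound suffices, so edge
bounds along a whole coding bound the forms everywhere. -/
lemma formBound_zero_of_closed {P : ℝ → ℝ → Prop} (hκ : κ ≤ 1 / 3)
    (hedge : ∀ t v, P t v → IsEdgeBound κ t v)
    (hstep : ∀ t v, P t v → ∃ x, 0 < x ∧
      (t = bend x ∧ P x (bend v) ∨ t = straight x ∧ P x (straight v))) (h : P t v) :
    FormBound κ 0 t v := by
  have key (n : ℕ) : ∀ t v, P t v → FormBoundOn κ (IsEdgeBound.triangle n) t v := by
    induction n with
    | zero =>
      intro t v h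
      have hempty (p q : ℕ) : (p, q) ∉ IsEdgeBound.triangle 0 := fun hpq => hpq.1.not_ge hpq.2
      exact ⟨(hedge t v h).pos_left, (hedge t v h).pos_right,
        fun p q hpq => absurd hpq (hempty p q), fun p q hpq => absurd hpq (hempty p q)⟩
    | succ n ih =>
      intro t v h
      obtain ⟨x, hx, ⟨rfl, hnext⟩ | ⟨rfl, hnext⟩⟩ := hstep t v h
      · exact (hedge _ _ h).formBoundOn_bend hκ hx (ih _ _ hnext)
      · exact (hedge _ _ h).formBoundOn_straight hκ hx (ih _ _ hnext)
  exact ⟨(hedge t v h).pos_left, (hedge t v h).pos_right,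
    fun p q hpq => (key (p + q) t v h).le_left p q ⟨hpq, le_rfl⟩,
    fun p q hpq => (key (p + q) t v h).le_right p q ⟨hpq, le_rfl⟩⟩

end EdgeBound

section Cycle

variable {i j k K : ℕ} {w w' x y κ : ℝ}

lemma FormBound.of_bend_iterate (h : FormBound κ K (bend^[j] x) y) (hx : 0 < x) :
    FormBound κ (K - j) x (bend^[j] y) := by
  induction j generalizing x with
  | zero => exact h
  | succ j ih =>
    have hbend : FormBound κ (K - j) (bend x) (bend^[j] y) := ih h (bend_pos hx)
    rw [Function.iterate_succ_apply', ← Nat.sub_sub]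
    exact hbend.of_bend hx

lemma bend_mem_Icc (hx : x ∈ Set.Icc (7 / 12) (4 / 5)) : bend x ∈ Set.Icc (3 / 4) (4 / 5) := by
  have hden : 0 < 3 * x + 1 := by linarith [hx.1]
  rw [bend_eq]
  exact ⟨(le_div_iff₀ hden).2 (by linarith [hx.2]), (div_le_iff₀ hden).2 (by linarith [hx.1])⟩

lemma bend_iterate_mem_Icc (i : ℕ) (hx : x ∈ Set.Icc (7 / 12) (4 / 5)) :
    bend^[i] x ∈ Set.Icc (7 / 12) (4 / 5) := by
  have hmaps : Set.MapsTo bend (Set.Icc (7 / 12) (4 / 5)) (Set.Icc (7 / 12) (4 / 5)) :=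
    fun x hx => Set.Icc_subset_Icc_left (by norm_num) (bend_mem_Icc hx)
  exact hmaps.iterate i hx

/-- The reciprocal of the least value of the forms along a cycle with fixed point `w`. -/
noncomputable def cycleHeight (w : ℝ) : ℝ := 3 * w + (straight w)⁻¹

lemma cycleHeight_mul_straight (hw : 0 < w) :
    cycleHeight w * straight w = 3 * w * straight w + 1 := by
  rw [cycleHeight, add_mul, inv_mul_cancel₀ (straight_pos hw).ne']

lemma cycleHeight_pos (hw : 0 < w) : 0 < cycleHeight w := by
  have := straight_pos hw
  unfold cycleHeight
  positivity

lemma cycleHeight_bendFix : cycleHeight bendFix = 4 := by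
  have hpos := bendFix_pos
  rw [cycleHeight, straight_eq, inv_div]
  field_simp
  linarith [three_mul_bendFix_sq]

lemma continuousAt_cycleHeight (hw : 0 < w) : ContinuousAt cycleHeight w := by
  have hstraight : ContinuousAt straight w := by
    rw [funext straight_eq]
    exact ContinuousAt.div (by fun_prop) (by fun_prop) (by positivity)
  exact ContinuousAt.add (by fun_prop) (hstraight.inv₀ (straight_pos hw).ne')

lemma cycleHeight_lt_four (hw : 0 < w) (h : w < bendFix) : cycleHeight w < 4 := by
  have hsq : 3 * w ^ 2 < w + 1 := by
    have hprod := mul_pos (sub_pos.2 h) (sub_pos.2 (bendConj_neg.trans hw))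
    unfold bendConj at hprod
    linarith [three_mul_bendFix_sq]
  rw [cycleHeight, straight_eq, inv_div, ← lt_sub_iff_add_lt', div_lt_iff₀ (by positivity)]
  linarith

namespace IsCycle

lemma unique (h : IsCycle k w) (h' : IsCycle k w') : w = w' := by
  have hle := h'.abs_bend_iterate_straight_sub_le h.pos
  rw [h.eq] at hle
  have := abs_nonneg (w - w')
  exact sub_eq_zero.1 (abs_eq_zero.1 (by linarith))

lemma mem_Ioo (h : IsCycle k w) (hk : 1 ≤ k) : w ∈ Set.Ioo (2 / 3) 1 := by
  obtain ⟨j, rfl⟩ := Nat.exists_eq_add_of_le' hk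
  have hpos := bend_iterate_pos j (straight_pos h.pos)
  rw [← h.eq, Function.iterate_succ_apply']
  exact ⟨two_thirds_lt_bend hpos, bend_lt_one hpos⟩

lemma straight_mem_Icc (h : IsCycle k w) (hk : 1 ≤ k) :
    straight w ∈ Set.Icc (7 / 12) (4 / 5) :=
  Set.Icc_subset_Icc_right (by norm_num) (straight_mem_Icc_of_mem_Ioo (h.mem_Ioo hk))

lemma mem_Icc (h : IsCycle k w) (hk : 1 ≤ k) : w ∈ Set.Icc (3 / 4) (4 / 5) := by
  obtain ⟨j, rfl⟩ := Nat.exists_eq_add_of_le' hk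
  rw [← h.eq, Function.iterate_succ_apply']
  exact bend_mem_Icc (bend_iterate_mem_Icc j (h.straight_mem_Icc hk))

lemma le_cycleHeight (h : IsCycle k w) (hk : 1 ≤ k) : 3.9 ≤ cycleHeight w := by
  have hw := h.mem_Icc hk
  have hs : (3 / 5)⁻¹ ≤ (straight w)⁻¹ :=
    inv_anti₀ (straight_pos h.pos) (straight_mem_Icc_of_mem_Ioo (h.mem_Ioo hk)).2
  unfold cycleHeight
  linarith [hw.1]

/-- With equality at the `straight` move, where `i = 0`. -/
lemma edge_le (h : IsCycle k w) (hk : 1 ≤ k) (hij : i + j = k) :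
    3 * bend^[i] (straight w) * bend^[j] (straight w) + 1 ≤
      cycleHeight w * bend^[i] (straight w) := by
  have hj := bend_iterate_mem_Icc j (h.straight_mem_Icc hk)
  cases i with
  | zero =>
    obtain rfl : j = k := by omega
    rw [Function.iterate_zero_apply, h.eq, cycleHeight_mul_straight h.pos]
    linarith
  | succ i =>
    have hi := bend_mem_Icc (bend_iterate_mem_Icc i (h.straight_mem_Icc hk))
    rw [← Function.iterate_succ_apply' bend] at hi
    nlinarith [h.le_cycleHeight hk, hi.1, hj.2]

lemma formBound (h : IsCycle k w) (hk : 1 ≤ k) :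
    FormBound (cycleHeight w)⁻¹ 0 w (straight w) := by
  have hheight := cycleHeight_pos h.pos
  refine formBound_zero_of_closed
    (P := fun t v => ∃ i j, i + j = k ∧ t = bend^[i] (straight w) ∧ v = bend^[j] (straight w))
    ((inv_anti₀ three_pos (by linarith [h.le_cycleHeight hk])).trans_eq (by norm_num)) ?_ ?_
    ⟨k, 0, rfl, h.eq.symm, rfl⟩
  · rintro _ _ ⟨i, j, hij, rfl, rfl⟩
    have hi := bend_iterate_mem_Icc i (h.straight_mem_Icc hk)
    have hj := bend_iterate_mem_Icc j (h.straight_mem_Icc hk)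
    refine ⟨by linarith [hi.1], by linarith [hi.2], by linarith [hj.1], by linarith [hj.2],
      (inv_mul_le_iff₀ hheight).2 (h.edge_le hk hij), (inv_mul_le_iff₀ hheight).2 ?_⟩
    rw [mul_right_comm]
    exact h.edge_le hk (by omega)
  · rintro _ _ ⟨i, j, hij, rfl, rfl⟩
    cases i with
    | zero =>
      obtain rfl : j = k := by omega
      exact ⟨w, h.pos, Or.inr ⟨rfl, j, 0, rfl, h.eq.symm, by rw [h.eq]; rfl⟩⟩
    | succ i =>
      exact ⟨bend^[i] (straight w), bend_iterate_pos i (straight_pos h.pos),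
        Or.inl ⟨Function.iterate_succ_apply' .., i, j + 1, by omega, rfl,
          (Function.iterate_succ_apply' ..).symm⟩⟩

lemma formBound_zero (h : IsCycle k w) (hbound : FormBound κ K w (straight w)) :
    FormBound κ 0 w (straight w) := by
  induction K with
  | zero => exact hbound
  | succ K ih =>
    refine ih ?_
    have hturn : FormBound κ (K + 1 - k) (straight w) (bend^[k] (straight w)) :=
      FormBound.of_bend_iterate (by rwa [h.eq]) (straight_pos h.pos)
    rw [h.eq] at hturn
    refine FormBoundOn.mono (hturn.of_straight h.pos) fun x hx => ?_
    simp only [Set.mem_ofPred_eq] at hx ⊢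
    omega

lemma lagrangeValue_eq (h : IsCycle k w) (hk : 1 ≤ k) :
    lagrangeValue w = ENNReal.ofReal (√3 * (cycleHeight w)⁻¹) := by
  have hs := straight_pos h.pos
  refine le_antisymm (lagrangeValue_le_of_forall_lt fun c c' hc hbound => ?_)
    (ofReal_mul_le_of_forall_lt fun κ hκ =>
      ((h.formBound hk).biApproxBound hκ).ofReal_le_lagrangeValue)
  obtain ⟨K, hK⟩ := hbound.exists_formBound h.pos hs hc
  have hedge := (h.formBound_zero hK).mul_le_right
  rw [← cycleHeight_mul_straight h.pos, ← mul_assoc, mul_le_iff_le_one_left hs] at hedge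
  have hle : c' ≤ (cycleHeight w)⁻¹ := by
    rwa [← one_div, le_div_iff₀ (cycleHeight_pos h.pos)]
  gcongr

lemma lt_bendFix (h : IsCycle k w) (hk : 1 ≤ k) (heven : Even k) : w < bendFix := by
  have hw := h.mem_Ioo hk
  have hcoord : 0 < bendCoord w := by
    rw [← h.eq, bendCoord_bend_iterate k (straight_pos h.pos)]
    have hmult : bendMult ≠ 0 := by linarith [bendMult_mem_Ioo.2]
    exact mul_pos (heven.pow_pos hmult) (by linarith [(bendCoord_straight_mem_Icc hw).1])
  have hpole : 0 < w - bendConj := by linarith [bendConj_neg, h.pos]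
  exact sub_pos.1 ((div_pos_iff_of_pos_right hpole).1 hcoord)

lemma abs_sub_bendFix_le (h : IsCycle k w) : |w - bendFix| ≤ (1 / 2) ^ k := by
  have hs := straight_pos h.pos
  have hiterate (j : ℕ) : |bend^[j] (straight w) - bendFix| ≤ (1 / 2) ^ j := by
    induction j with
    | zero =>
      have := straight_lt_two_thirds h.pos
      rw [Function.iterate_zero_apply, pow_zero, abs_le]
      constructor <;> linarith [bendFix_mem_Ioo.1, bendFix_mem_Ioo.2]
    | succ j ih =>
      rw [Function.iterate_succ_apply', pow_succ']
      exact (abs_bend_sub_bendFix_le (bend_iterate_pos j hs)).trans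
        (mul_le_mul_of_nonneg_left ih (by norm_num))
  simpa only [h.eq] using hiterate k

end IsCycle

lemma tendsto_inv_cycleHeight {w : ℕ → ℝ} (hw : ∀ k, IsCycle k (w k)) :
    Tendsto (fun k => √3 * (cycleHeight (w k))⁻¹) atTop (𝓝 (√3 / 4)) := by
  have hfix : Tendsto w atTop (𝓝 bendFix) := by
    rw [tendsto_iff_norm_sub_tendsto_zero]
    exact squeeze_zero (fun _ => norm_nonneg _) (fun k => (hw k).abs_sub_bendFix_le)
      (tendsto_pow_atTop_nhds_zero_of_lt_one (by norm_num) (by norm_num))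
  have hheight : Tendsto (fun k => cycleHeight (w k)) atTop (𝓝 4) :=
    cycleHeight_bendFix ▸ (continuousAt_cycleHeight bendFix_pos).tendsto.comp hfix
  exact (hheight.inv₀ (by norm_num)).const_mul _

end Cycle

section Parametrization

variable {a b n p q : ℕ}

/-- The Eisenstein pairs that approximate the direction with parameter `t` according to how well
`p / q` approximates `t`. -/
def leftPair (p q : ℕ) : ℕ × ℕ := (3 * p ^ 2 + 2 * p * q, 2 * p * q + q ^ 2)

/-- The Eisenstein pairs that approximate the direction with parameter `t` according to how well
`p / q` approximates `3 * t`. -/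
def rightPair (p q : ℕ) : ℕ × ℕ := (p ^ 2 + 2 * p * q, 2 * p * q + 3 * q ^ 2)

lemma isEisensteinPair_leftPair (hp : 0 < p) (hq : 0 < q) : IsEisensteinPair (leftPair p q) :=
  ⟨by unfold leftPair; positivity, by unfold leftPair; positivity,
    3 * p ^ 2 + 3 * p * q + q ^ 2, by unfold leftPair; ring⟩

lemma isEisensteinPair_rightPair (hp : 0 < p) (hq : 0 < q) : IsEisensteinPair (rightPair p q) :=
  ⟨by unfold rightPair; positivity, by unfold rightPair; positivity,
    p ^ 2 + 3 * p * q + 3 * q ^ 2, by unfold rightPair; ring⟩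

lemma coprime_leftPair (h : (3 * p).Coprime q) :
    (leftPair p q).1.Coprime (leftPair p q).2 := by
  obtain ⟨x, y, hxy⟩ := Nat.isCoprime_iff_coprime.2 h
  push_cast at hxy
  have hp_q : IsCoprime (p : ℤ) q := ⟨3 * x, y, by linear_combination hxy⟩
  have hp_sum : IsCoprime (p : ℤ) (2 * p + q) := ⟨3 * x - 2 * y, y, by linear_combination hxy⟩
  have hsum_q : IsCoprime (3 * p + 2 * q : ℤ) q := ⟨x, y - 2 * x, by linear_combination hxy⟩
  have hsum_sum : IsCoprime (3 * p + 2 * q : ℤ) (2 * p + q) :=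
    ⟨2 * y - 3 * x, 6 * x - 3 * y, by linear_combination hxy⟩
  have hmul := (hp_q.mul_right hp_sum).mul_left (hsum_q.mul_right hsum_sum)
  rw [← Nat.isCoprime_iff_coprime]
  convert hmul using 1 <;> simp only [leftPair] <;> push_cast <;> ring

lemma coprime_rightPair (h : p.Coprime q) (h₃ : ¬3 ∣ p) :
    (rightPair p q).1.Coprime (rightPair p q).2 := by
  have hp_three : IsCoprime (p : ℤ) 3 :=
    Nat.isCoprime_iff_coprime.2 ((Nat.prime_three.coprime_iff_not_dvd).2 h₃).symm
  obtain ⟨x, y, hxy⟩ := Nat.isCoprime_iff_coprime.2 h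
  have hp_q : IsCoprime (p : ℤ) q := ⟨x, y, hxy⟩
  obtain ⟨X, Y, hXY⟩ := hp_three.mul_right hp_q
  have hp_sum : IsCoprime (p : ℤ) (2 * p + 3 * q) := ⟨X - 2 * Y, Y, by linear_combination hXY⟩
  have hsum_q : IsCoprime (p + 2 * q : ℤ) q := ⟨x, y - 2 * x, by linear_combination hxy⟩
  have hsum_sum : IsCoprime (p + 2 * q : ℤ) (2 * p + 3 * q) :=
    ⟨2 * y - 3 * x, 2 * x - y, by linear_combination hxy⟩
  have hmul := (hp_q.mul_right hp_sum).mul_left (hsum_q.mul_right hsum_sum)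
  rw [← Nat.isCoprime_iff_coprime]
  convert hmul using 1 <;> simp only [rightPair] <;> push_cast <;> ring

lemma exists_eq_smul_of_mul_eq_mul {x : ℕ × ℕ} (hx : x.1.Coprime x.2) (hpos : 0 < x.1)
    (h : a * x.2 = b * x.1) : ∃ r : ℕ, (a, b) = r • x := by
  obtain ⟨r, rfl⟩ : x.1 ∣ a := hx.dvd_of_dvd_mul_right (Dvd.intro_left b h.symm)
  refine ⟨r, Prod.ext (mul_comm _ _) (Nat.eq_of_mul_eq_mul_right hpos ?_)⟩
  rw [← h, Prod.smul_snd, smul_eq_mul]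
  ring

namespace IsEisensteinPair

lemma swap (h : IsEisensteinPair (a, b)) : IsEisensteinPair (b, a) := by
  obtain ⟨ha, hb, c, hc⟩ := h
  exact ⟨hb, ha, c, by linarith⟩

/-- With `a² + ab + b² = c²`, the fraction `p / q` is `(a + c - b) / b`. -/
lemma exists_mul_eq_mul (h : IsEisensteinPair (a, b)) :
    ∃ p q, 0 < p ∧ 0 < q ∧ p.Coprime q ∧ a * (rightPair p q).2 = b * (rightPair p q).1 := by
  obtain ⟨ha, hb, c, hc⟩ := h
  dsimp only at ha hb hc
  have hbc : b ≤ c := by nlinarith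
  obtain ⟨e, rfl⟩ := Nat.exists_eq_add_of_le hbc
  obtain ⟨g, p, q, hg, hpq, hp, hq⟩ :=
    Nat.exists_coprime' (m := a + e) (n := b) (Nat.gcd_pos_of_pos_right _ hb)
  refine ⟨p, q, Nat.pos_of_ne_zero ?_, Nat.pos_of_ne_zero ?_, hpq,
    Nat.eq_of_mul_eq_mul_right (mul_pos hg hg) ?_⟩
  · rintro rfl
    omega
  · rintro rfl
    omega
  · calc a * (rightPair p q).2 * (g * g)
        = a * (2 * (p * g) * (q * g) + 3 * (q * g) ^ 2) := by unfold rightPair; ring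
      _ = a * (2 * (a + e) * b + 3 * b ^ 2) := by rw [← hp, ← hq]
      _ = b * ((a + e) ^ 2 + 2 * (a + e) * b) := by linear_combination b * hc
      _ = b * ((p * g) ^ 2 + 2 * (p * g) * (q * g)) := by rw [← hp, ← hq]
      _ = b * (rightPair p q).1 * (g * g) := by unfold rightPair; ring

lemma exists_eq_smul {x : ℕ × ℕ} (h : IsEisensteinPair x) :
    ∃ r p q : ℕ, 0 < r ∧ 0 < p ∧ 0 < q ∧ (x = r • leftPair p q ∨ x = r • rightPair p q) := by
  obtain ⟨a, b⟩ := x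
  obtain ⟨p, q, hp, hq, hpq, hratio⟩ := h.exists_mul_eq_mul
  have hr {r : ℕ} {y : ℕ × ℕ} (hy : (a, b) = r • y) : 0 < r := by
    refine Nat.pos_of_ne_zero ?_
    rintro rfl
    rw [zero_smul] at hy
    exact h.1.ne' (congrArg Prod.fst hy)
  by_cases h₃ : 3 ∣ p
  · obtain ⟨p, rfl⟩ := h₃
    have hratio' : a * (leftPair p q).2 = b * (leftPair p q).1 := by
      refine Nat.eq_of_mul_eq_mul_left three_pos ?_
      simp only [leftPair, rightPair] at hratio ⊢
      linear_combination hratio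
    obtain ⟨r, hab⟩ := exists_eq_smul_of_mul_eq_mul (coprime_leftPair hpq)
      (isEisensteinPair_leftPair (by omega) hq).1 hratio'
    exact ⟨r, p, q, hr hab, by omega, hq, Or.inl hab⟩
  · obtain ⟨r, hab⟩ := exists_eq_smul_of_mul_eq_mul (coprime_rightPair hpq h₃)
      (isEisensteinPair_rightPair hp hq).1 hratio
    exact ⟨r, p, q, hr hab, hp, hq, Or.inr hab⟩

lemma two_mul_le (h : IsEisensteinPair (a, b)) : 2 * a ≤ 3 * b ^ 2 := by
  obtain ⟨ha, hb, c, hc⟩ := h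
  dsimp only at ha hb hc
  have hc' : 2 * a + b < 2 * c := by nlinarith
  nlinarith

lemma le_snd (h : IsEisensteinPair (a, b)) (hn : n + 3 * n ^ 2 ≤ a + b) : n ≤ b := by
  by_contra! hlt
  have := Nat.pow_le_pow_left hlt.le 2
  have := h.two_mul_le
  omega

end IsEisensteinPair

end Parametrization

section RayDist

variable {α β : ℝ}

/-- The complex number with coordinates `a`, `b` in the basis `1`, `ω`. -/
noncomputable def eisensteinCoord (a b : ℝ) : ℂ := a + b * eisensteinOmega

lemma eisensteinCoord_re (a b : ℝ) : (eisensteinCoord a b).re = a + b / 2 := by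
  simp only [eisensteinCoord, eisensteinOmega, Complex.add_re, Complex.mul_re, Complex.ofReal_re,
    Complex.ofReal_im, Complex.div_ofNat_re, Complex.one_re, Complex.I_re, Complex.I_im]
  ring

lemma eisensteinCoord_im (a b : ℝ) : (eisensteinCoord a b).im = b * √3 / 2 := by
  simp only [eisensteinCoord, eisensteinOmega, Complex.add_im, Complex.mul_im, Complex.ofReal_re,
    Complex.ofReal_im, Complex.div_ofNat_im, Complex.one_im, Complex.I_re, Complex.I_im]
  ring

lemma norm_eisensteinCoord (a b : ℝ) : ‖eisensteinCoord a b‖ = √(a ^ 2 + a * b + b ^ 2) := by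
  have hsqrt : √3 * √3 = 3 := Real.mul_self_sqrt zero_le_three
  rw [Complex.norm_def, Complex.normSq_apply, eisensteinCoord_re, eisensteinCoord_im]
  congr 1
  linear_combination (b ^ 2 / 4) * hsqrt

lemma exists_eq_eisensteinCoord (z : ℂ) : ∃ a b, z = eisensteinCoord a b := by
  have hsqrt : √3 ≠ 0 := by positivity
  refine ⟨z.re - z.im / √3, 2 * z.im / √3, Complex.ext ?_ ?_⟩
  · rw [eisensteinCoord_re]
    ring
  · rw [eisensteinCoord_im]
    field_simp

lemma eisensteinPoint_eq (x : ℕ × ℕ) : eisensteinPoint x = eisensteinCoord x.1 x.2 := by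
  simp only [eisensteinPoint, eisensteinCoord, Complex.ofReal_natCast]

lemma norm_eisensteinPoint_mem_Icc (x : ℕ × ℕ) :
    ‖eisensteinPoint x‖ ∈ Set.Icc ((x.1 + x.2 : ℝ) / 2) (x.1 + x.2) := by
  rw [eisensteinPoint_eq, norm_eisensteinCoord]
  have hmul : (0 : ℝ) ≤ x.1 * x.2 := by positivity
  exact ⟨Real.le_sqrt_of_sq_le (by nlinarith [sq_nonneg (x.1 + x.2 : ℝ)]),
    Real.sqrt_le_iff.2 ⟨by positivity, by linarith⟩⟩

lemma eventually_comap_norm_eisensteinPoint_iff {P : {x : ℕ × ℕ // IsEisensteinPair x} → Prop} :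
    (∀ᶠ x in comap (fun x : {x : ℕ × ℕ // IsEisensteinPair x} => ‖eisensteinPoint x.1‖) atTop,
      P x) ↔ ∃ N : ℕ, ∀ x, N ≤ x.1.1 + x.1.2 → P x := by
  rw [(atTop_basis.comap _).eventually_iff]
  constructor
  · rintro ⟨R, -, hR⟩
    obtain ⟨N, hN⟩ := exists_nat_ge (2 * R)
    refine ⟨N, fun x hx => hR ?_⟩
    have hcast : (N : ℝ) ≤ x.1.1 + x.1.2 := by exact_mod_cast hx
    exact le_trans (by linarith) (norm_eisensteinPoint_mem_Icc x.1).1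
  · rintro ⟨N, hN⟩
    refine ⟨N, trivial, fun x hx => hN x ?_⟩
    exact_mod_cast le_trans (Set.mem_Ici.1 hx) (norm_eisensteinPoint_mem_Icc x.1).2

lemma edist_eisensteinPoint (x : ℕ × ℕ) (α β τ : ℝ) :
    edist (eisensteinPoint x) (τ * eisensteinCoord α β) = ENNReal.ofReal
      √((x.1 - τ * α) ^ 2 + (x.1 - τ * α) * (x.2 - τ * β) + (x.2 - τ * β) ^ 2) := by
  rw [edist_dist, dist_eq_norm, eisensteinPoint_eq, ← norm_eisensteinCoord]
  congr 2
  simp only [eisensteinCoord]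
  push_cast
  ring

/-- The orthogonal projection of the point to the line has a nonnegative coordinate, so that it lies
on the half-line. -/
lemma rayDist_eisensteinCoord (hα : 0 < α) (hβ : 0 < β) (hnorm : α ^ 2 + α * β + β ^ 2 = 1)
    (x : ℕ × ℕ) :
    rayDist (eisensteinCoord α β) x = ENNReal.ofReal (√3 / 2 * |x.1 * β - x.2 * α|) := by
  set proj := x.1 * α + x.2 * β + (x.1 * β + x.2 * α) / 2 with hproj
  have hpythagoras (τ : ℝ) :
      (x.1 - τ * α) ^ 2 + (x.1 - τ * α) * (x.2 - τ * β) + (x.2 - τ * β) ^ 2 =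
        (τ - proj) ^ 2 + 3 / 4 * (x.1 * β - x.2 * α) ^ 2 := by
    rw [hproj]
    linear_combination (τ ^ 2 - (x.1 : ℝ) ^ 2 - x.1 * x.2 - (x.2 : ℝ) ^ 2) * hnorm
  have hdist : √3 / 2 * |x.1 * β - x.2 * α| = √(3 / 4 * (x.1 * β - x.2 * α) ^ 2) := by
    rw [Real.sqrt_mul (by norm_num), Real.sqrt_sq_eq_abs, Real.sqrt_div zero_le_three,
      show (4 : ℝ) = 2 ^ 2 by norm_num, Real.sqrt_sq zero_le_two]
  rw [hdist]
  refine le_antisymm ?_ (Metric.le_infEDist.2 ?_)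
  · have hmem : proj * eisensteinCoord α β ∈ halfLine (eisensteinCoord α β) :=
      ⟨proj, by positivity, rfl⟩
    refine (Metric.infEDist_le_edist_of_mem hmem).trans_eq ?_
    rw [edist_eisensteinPoint, hpythagoras, sub_self, zero_pow two_ne_zero, zero_add]
  · rintro _ ⟨τ, -, rfl⟩
    rw [edist_eisensteinPoint, hpythagoras]
    gcongr
    exact le_add_of_nonneg_left (sq_nonneg _)

lemma le_rayDist_of_nonpos (h : α ≤ 0 ∨ β ≤ 0) {x : ℕ × ℕ} {m : ℕ} (hfst : 2 * m ≤ x.1)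
    (hsnd : 2 * m ≤ x.2) : (m : ENNReal) ≤ rayDist (eisensteinCoord α β) x := by
  refine Metric.le_infEDist.2 ?_
  rintro _ ⟨τ, hτ, rfl⟩
  rw [edist_eisensteinPoint, ← ENNReal.ofReal_natCast]
  refine ENNReal.ofReal_le_ofReal (Real.le_sqrt_of_sq_le ?_)
  rify at hfst hsnd
  have hm : (0 : ℝ) ≤ 2 * m := by positivity
  rcases h with h | h
  · have hcoord : 2 * (m : ℝ) ≤ x.1 - τ * α := by
      linarith [mul_nonpos_of_nonneg_of_nonpos hτ h]
    nlinarith [sq_nonneg ((x.2 - τ * β) + (x.1 - τ * α) / 2), pow_le_pow_left₀ hm hcoord 2]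
  · have hcoord : 2 * (m : ℝ) ≤ x.2 - τ * β := by
      linarith [mul_nonpos_of_nonneg_of_nonpos hτ h]
    nlinarith [sq_nonneg ((x.1 - τ * α) + (x.2 - τ * β) / 2), pow_le_pow_left₀ hm hcoord 2]

lemma eisensteinDelta_eq_top (h : α ≤ 0 ∨ β ≤ 0) :
    eisensteinDelta (eisensteinCoord α β) = ⊤ := by
  refine ENNReal.eq_top_of_forall_nnreal_le fun r => ?_
  obtain ⟨m, hm⟩ := exists_nat_ge r
  have hm' : (r : ENNReal) ≤ m := by exact_mod_cast hm
  refine hm'.trans (le_liminf_of_le (by isBoundedDefault) ?_)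
  refine eventually_comap_norm_eisensteinPoint_iff.2 ⟨2 * m + 3 * (2 * m) ^ 2, ?_⟩
  exact fun x hx => le_rayDist_of_nonpos h
    (x.2.swap.le_snd (hx.trans_eq (add_comm _ _))) (x.2.le_snd hx)

end RayDist

section Direction

variable {t c c' κ : ℝ} {K N r p q : ℕ}

/-- The unit vector in the direction with parameter `t`, which is the limit direction of the pairs
`leftPair p q` for `p / q → t` and of the pairs `rightPair p q` for `p / q → 3 * t`. -/
noncomputable def eisensteinDir (t : ℝ) : ℂ :=
  eisensteinCoord ((3 * t ^ 2 + 2 * t) / (3 * t ^ 2 + 3 * t + 1))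
    ((2 * t + 1) / (3 * t ^ 2 + 3 * t + 1))

lemma eisensteinDir_normSq (ht : 0 < t) :
    ((3 * t ^ 2 + 2 * t) / (3 * t ^ 2 + 3 * t + 1)) ^ 2 +
      (3 * t ^ 2 + 2 * t) / (3 * t ^ 2 + 3 * t + 1) * ((2 * t + 1) / (3 * t ^ 2 + 3 * t + 1)) +
      ((2 * t + 1) / (3 * t ^ 2 + 3 * t + 1)) ^ 2 = 1 := by
  field_simp
  ring

lemma norm_eisensteinDir (ht : 0 < t) : ‖eisensteinDir t‖ = 1 := by
  rw [eisensteinDir, norm_eisensteinCoord, eisensteinDir_normSq ht, Real.sqrt_one]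

lemma exists_eq_eisensteinDir {α β : ℝ} (hα : 0 < α) (hβ : 0 < β)
    (hnorm : α ^ 2 + α * β + β ^ 2 = 1) : ∃ t, 0 < t ∧ eisensteinCoord α β = eisensteinDir t := by
  have hβ1 : β < 1 := by nlinarith
  have hnum : 0 < 1 + α - β := by linarith
  refine ⟨(1 + α - β) / (3 * β), by positivity, ?_⟩
  have hden : 3 * ((1 + α - β) / (3 * β)) ^ 2 + 3 * ((1 + α - β) / (3 * β)) + 1 =
      (2 + 2 * α + β) / (3 * β ^ 2) := by
    field_simp
    linear_combination hnorm
  rw [eisensteinDir, hden]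
  congr 1
  · rw [eq_div_iff (by positivity)]
    field_simp
    linear_combination hnorm
  · rw [eq_div_iff (by positivity)]
    field_simp
    ring

lemma rayDist_eisensteinDir (ht : 0 < t) (x : ℕ × ℕ) :
    rayDist (eisensteinDir t) x = ENNReal.ofReal (√3 *
      (|x.1 * (2 * t + 1) - x.2 * (3 * t ^ 2 + 2 * t)| / (2 * (3 * t ^ 2 + 3 * t + 1)))) := by
  have hden : 0 < 3 * t ^ 2 + 3 * t + 1 := by positivity
  rw [eisensteinDir, rayDist_eisensteinCoord (by positivity) (by positivity)
    (eisensteinDir_normSq ht), mul_div_assoc', mul_div_assoc', ← sub_div, abs_div,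
    abs_of_pos hden]
  congr 1
  field_simp

lemma formValue_three_mul_straight (ht : 0 < t) (p q : ℕ) :
    formValue t (3 * straight t) p q = |(p : ℝ) - t * q| *
      (3 * (2 * t + 1) * p + (3 * t + 2) * q) / (2 * (3 * t ^ 2 + 3 * t + 1)) := by
  rw [formValue, straight_eq]
  field_simp
  ring

lemma formValue_straight (ht : 0 < t) (p q : ℕ) :
    formValue (3 * t) (straight t) p q = |(p : ℝ) - 3 * t * q| *
      ((2 * t + 1) * p + (3 * t + 2) * q) / (2 * (3 * t ^ 2 + 3 * t + 1)) := by
  rw [formValue, straight_eq]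
  field_simp
  ring

lemma rayDist_smul_leftPair (ht : 0 < t) (r p q : ℕ) :
    rayDist (eisensteinDir t) (r • leftPair p q) =
      ENNReal.ofReal (√3 * (r * formValue t (3 * straight t) p q)) := by
  have hfactor : ((r • leftPair p q).1 * (2 * t + 1) - (r • leftPair p q).2 * (3 * t ^ 2 + 2 * t)) =
      r * ((p - t * q) * (3 * (2 * t + 1) * p + (3 * t + 2) * q)) := by
    simp only [leftPair, Prod.smul_mk, smul_eq_mul]
    push_cast
    ring
  have hpos : 0 ≤ 3 * (2 * t + 1) * p + (3 * t + 2) * q := by positivity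
  rw [rayDist_eisensteinDir ht, hfactor, formValue_three_mul_straight ht, abs_mul, abs_mul,
    abs_of_nonneg hpos, Nat.abs_cast, mul_div_assoc]

lemma rayDist_smul_rightPair (ht : 0 < t) (r p q : ℕ) :
    rayDist (eisensteinDir t) (r • rightPair p q) =
      ENNReal.ofReal (√3 * (r * formValue (3 * t) (straight t) p q)) := by
  have hfactor :
      ((r • rightPair p q).1 * (2 * t + 1) - (r • rightPair p q).2 * (3 * t ^ 2 + 2 * t)) =
        r * ((p - 3 * t * q) * ((2 * t + 1) * p + (3 * t + 2) * q)) := by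
    simp only [rightPair, Prod.smul_mk, smul_eq_mul]
    push_cast
    ring
  have hpos : 0 ≤ (2 * t + 1) * p + (3 * t + 2) * q := by positivity
  rw [rayDist_eisensteinDir ht, hfactor, formValue_straight ht, abs_mul, abs_mul,
    abs_of_nonneg hpos, Nat.abs_cast, mul_div_assoc]

lemma formValue_nonneg {τ ν : ℝ} (hτ : 0 ≤ τ) (hν : 0 ≤ ν) (p q : ℕ) :
    0 ≤ formValue τ ν p q := by
  unfold formValue
  positivity

lemma formValue_mul_mul (τ ν : ℝ) (n p q : ℕ) :
    formValue τ ν (n * p) (n * q) = n ^ 2 * formValue τ ν p q := by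
  have hlin : (n * p - τ * (n * q) : ℝ) = n * (p - τ * q) := by ring
  unfold formValue
  push_cast
  rw [hlin, abs_mul, Nat.abs_cast]
  ring

/-- For small `p + q` the bound is applied to a large multiple of `(p, q)`. -/
lemma le_mul_formValue {τ ν : ℝ} (hτ : 0 ≤ τ) (hν : 0 ≤ ν) (hr : 0 < r) (hpq : 0 < p + q)
    (h : ∀ n : ℕ, K < n * p + n * q → κ ≤ formValue τ ν (n * p) (n * q))
    (hsize : (K + 1) ^ 4 ≤ r * (p + q) ^ 2) : κ ≤ r * formValue τ ν p q := by
  have hform := formValue_nonneg hτ hν p q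
  rcases lt_or_ge K (p + q) with hlarge | hsmall
  · have hone := h 1 (by omega)
    rw [one_mul, one_mul] at hone
    exact hone.trans (le_mul_of_one_le_left hform (by exact_mod_cast hr))
  · have hscale : (K + 1) ^ 2 ≤ r := by
      refine le_of_mul_le_mul_right ?_ (pow_pos K.succ_pos 2)
      calc (K + 1) ^ 2 * (K + 1) ^ 2 = (K + 1) ^ 4 := by ring
        _ ≤ r * (p + q) ^ 2 := hsize
        _ ≤ r * (K + 1) ^ 2 := Nat.mul_le_mul_left r (Nat.pow_le_pow_left (by omega) 2)
    have hmul := h (K + 1) (by nlinarith)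
    rw [formValue_mul_mul] at hmul
    exact hmul.trans (mul_le_mul_of_nonneg_right (by exact_mod_cast hscale) hform)

lemma FormBound.le_rayDist (h : FormBound κ K t (straight t)) {x : ℕ × ℕ}
    (hx : IsEisensteinPair x) (hsize : 3 * (K + 1) ^ 4 ≤ x.1 + x.2) :
    ENNReal.ofReal (√3 * κ) ≤ rayDist (eisensteinDir t) x := by
  have ht := h.pos_left
  have hs := h.pos_right
  obtain ⟨r, p, q, hr, hp, hq, rfl | rfl⟩ := hx.exists_eq_smul
  · rw [rayDist_smul_leftPair ht]
    gcongr
    refine le_mul_formValue ht.le (by positivity) hr (by omega) (fun n => h.le_left _ _) ?_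
    simp only [leftPair, Prod.smul_mk, smul_eq_mul] at hsize
    nlinarith [Nat.zero_le (r * (p * q)), Nat.zero_le (r * q ^ 2)]
  · rw [rayDist_smul_rightPair ht]
    gcongr
    refine le_mul_formValue (by positivity) hs.le hr (by omega) (fun n => h.le_right _ _) ?_
    simp only [rightPair, Prod.smul_mk, smul_eq_mul] at hsize
    nlinarith [Nat.zero_le (r * (p * q)), Nat.zero_le (r * p ^ 2)]

lemma biApproxBound_of_forall_le_rayDist (ht : 0 < t) (hc : c' < c)
    (h : ∀ x, IsEisensteinPair x → N ≤ x.1 + x.2 →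
      ENNReal.ofReal (√3 * c) ≤ rayDist (eisensteinDir t) x) : BiApproxBound t c' := by
  have hs := straight_pos ht
  have hofReal {f : ℝ} (hf : 0 ≤ f)
      (hle : ENNReal.ofReal (√3 * c) ≤ ENNReal.ofReal (√3 * ((1 : ℕ) * f))) : c ≤ f := by
    rw [Nat.cast_one, one_mul, ENNReal.ofReal_le_ofReal_iff (by positivity)] at hle
    exact le_of_mul_le_mul_left hle (by positivity)
  refine ⟨approxBound_of_le_formValue (ν := 3 * straight t) ht (by positivity) hc ?_,
    approxBound_of_le_formValue (ν := straight t) (by positivity) hs.le hc ?_⟩ <;>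
  filter_upwards [eventually_gt_atTop N] with q hq p hp
  · refine hofReal (formValue_nonneg ht.le (by positivity) p q) ?_
    rw [← rayDist_smul_leftPair ht, one_smul]
    refine h _ (isEisensteinPair_leftPair hp (by omega)) ?_
    unfold leftPair
    nlinarith
  · refine hofReal (formValue_nonneg (by positivity) hs.le p q) ?_
    rw [← rayDist_smul_rightPair ht, one_smul]
    refine h _ (isEisensteinPair_rightPair hp (by omega)) ?_
    unfold rightPair
    nlinarith

lemma lagrangeValue_le_eisensteinDelta (ht : 0 < t) :
    lagrangeValue t ≤ eisensteinDelta (eisensteinDir t) := by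
  refine lagrangeValue_le_of_forall_lt fun c c' hc hbound => ?_
  obtain ⟨K, hK⟩ := hbound.exists_formBound ht (straight_pos ht) hc
  exact le_liminf_of_le (by isBoundedDefault)
    (eventually_comap_norm_eisensteinPoint_iff.2 ⟨_, fun x => FormBound.le_rayDist hK x.2⟩)

lemma eisensteinDelta_le_lagrangeValue (ht : 0 < t) :
    eisensteinDelta (eisensteinDir t) ≤ lagrangeValue t := by
  refine ENNReal.le_of_forall_nnreal_lt fun y hy => ?_
  have hy_eq : (y : ENNReal) = ENNReal.ofReal (√3 * (y / √3)) := by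
    rw [mul_div_cancel₀ _ (by positivity), ENNReal.ofReal_coe_nnreal]
  obtain ⟨N, hN⟩ := eventually_comap_norm_eisensteinPoint_iff.1
    (eventually_lt_of_lt_liminf hy (by isBoundedDefault))
  rw [hy_eq] at hN ⊢
  exact ofReal_mul_le_of_forall_lt fun c' hc' =>
    (biApproxBound_of_forall_le_rayDist ht hc' fun x hx hsize =>
      (hN ⟨x, hx⟩ hsize).le).ofReal_le_lagrangeValue

lemma eisensteinDelta_eisensteinDir (ht : 0 < t) :
    eisensteinDelta (eisensteinDir t) = lagrangeValue t :=
  (eisensteinDelta_le_lagrangeValue ht).antisymm (lagrangeValue_le_eisensteinDelta ht)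

end Direction

section DeltaSet

variable {k : ℕ} {m w x : ℝ}

lemma mem_eisensteinDeltaSet_iff :
    x ∈ eisensteinDeltaSet ↔ ∃ t, 0 < t ∧ lagrangeValue t < ⊤ ∧ x = (lagrangeValue t).toReal := by
  constructor
  · rintro ⟨z, hz, hfin, hx⟩
    obtain ⟨α, β, rfl⟩ := exists_eq_eisensteinCoord z
    rw [norm_eisensteinCoord, Real.sqrt_eq_one] at hz
    have hpos : 0 < α ∧ 0 < β := by
      by_contra! hneg
      exact hfin.ne (eisensteinDelta_eq_top ((le_or_gt α 0).imp_right hneg))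
    obtain ⟨t, ht, hdir⟩ := exists_eq_eisensteinDir hpos.1 hpos.2 hz
    rw [hdir, eisensteinDelta_eisensteinDir ht] at hfin hx
    exact ⟨t, ht, hfin, hx⟩
  · rintro ⟨t, ht, h⟩
    rw [← eisensteinDelta_eisensteinDir ht] at h
    exact ⟨eisensteinDir t, norm_eisensteinDir ht, h⟩

lemma IsCycle.toReal_lagrangeValue (h : IsCycle k w) (hk : 1 ≤ k) :
    (lagrangeValue w).toReal = √3 * (cycleHeight w)⁻¹ := by
  have := cycleHeight_pos h.pos
  rw [h.lagrangeValue_eq hk, ENNReal.toReal_ofReal (by positivity)]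

lemma IsCycle.mem_eisensteinDeltaSet (h : IsCycle k w) (hk : 1 ≤ k) :
    √3 * (cycleHeight w)⁻¹ ∈ eisensteinDeltaSet :=
  mem_eisensteinDeltaSet_iff.2
    ⟨w, h.pos, h.lagrangeValue_eq hk ▸ ENNReal.ofReal_lt_top, (h.toReal_lagrangeValue hk).symm⟩

lemma accPt_eisensteinDeltaSet : AccPt (√3 / 4) (𝓟 eisensteinDeltaSet) := by
  choose w hw using exists_isCycle
  rw [accPt_iff_frequently]
  refine (tendsto_inv_cycleHeight hw).frequently
    ((Nat.frequently_even.and_eventually (eventually_ge_atTop 1)).mono ?_)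
  rintro k ⟨heven, hk⟩
  have hlt : cycleHeight (w k) < 4 :=
    cycleHeight_lt_four (hw k).pos ((hw k).lt_bendFix hk heven)
  have hgt : √3 / 4 < √3 * (cycleHeight (w k))⁻¹ := by
    rw [← div_eq_mul_inv]
    exact div_lt_div_of_pos_left (by positivity) (cycleHeight_pos (hw k).pos) hlt
  exact ⟨hgt.ne', (hw k).mem_eisensteinDeltaSet hk⟩

lemma finite_Ioi_inter_eisensteinDeltaSet (hm : √3 / 4 < m) :
    (Set.Ioi m ∩ eisensteinDeltaSet).Finite := by
  choose w hw using exists_isCycle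
  have hfinite : {k | ¬√3 * (cycleHeight (w k))⁻¹ < m}.Finite := by
    rw [← eventually_cofinite, Nat.cofinite_eq_atTop]
    exact (tendsto_inv_cycleHeight hw).eventually_lt_const hm
  refine ((hfinite.image fun k => √3 * (cycleHeight (w k))⁻¹).insert
    (lagrangeValue (√3)⁻¹).toReal |>.insert (lagrangeValue bendFix).toReal).subset ?_
  rintro x ⟨hmx, hx⟩
  obtain ⟨t, ht, hfin, rfl⟩ := mem_eisensteinDeltaSet_iff.1 hx
  rw [Set.mem_Ioi] at hmx
  have hgt : ENNReal.ofReal (√3 / 4) < lagrangeValue t :=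
    (ENNReal.ofReal_lt_iff_lt_toReal (by positivity) hfin.ne).2 (hm.trans hmx)
  rcases isClassified_lagrangeValue ht hgt with heq | heq | ⟨k, u, hk, -, hu, heq⟩
  · exact Or.inl (by rw [heq])
  · exact Or.inr (Or.inl (by rw [heq]))
  · obtain rfl := hu.unique (hw k)
    rw [heq, hu.toReal_lagrangeValue hk] at hmx ⊢
    exact Or.inr (Or.inr ⟨k, hmx.not_gt, rfl⟩)

end DeltaSet

/-- `√3 / 4` is the greatest accumulation point of `{δ(z) : |z| = 1, δ(z) < ∞}`. -/
theorem theorem1p2 :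
    IsGreatest {x : ℝ | AccPt x (𝓟 eisensteinDeltaSet)} (Real.sqrt 3 / 4) := by
  refine ⟨accPt_eisensteinDeltaSet, fun x hx => le_of_not_gt fun hlt => ?_⟩
  obtain ⟨m, hm, hmx⟩ := exists_between hlt
  have hacc : AccPt x (𝓟 (Set.Ioi m ∩ eisensteinDeltaSet)) := hx.nhds_inter (Ioi_mem_nhds hmx)
  exact Set.Infinite.of_accPt hacc (finite_Ioi_inter_eisensteinDeltaSet hm)
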